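/- All logarithms are to base $2$. Let $q\ge 4$ be even, $0<\epsilon\le 1/2$, and let $W$ be the typewriter channel with input and output alphabet $\mathbb{Z}_q$, $W(x|x)=1-\epsilon$, $W(x+1|x)=\epsilon$ (addition mod $q$), all other transition probabilities being $0$. Its reliability function is $$E(R)=\limsup_{n\to\infty}\frac1n\log\frac{1}{\mathsf P_e(\lceil 2^{nR}\rceil,n)},$$ where $\mathsf P_e(M,n)$ is the smallest probability of error (average or maximal over the codewords; the claims below hold for either choice) of codes with $M$ codewords of length $n$, and the exponent is $+\infty$ where $\mathsf P_e=0$. Put $\alpha=\sqrt{\epsilon(1-\epsilon)}$, $h_2(x)=-x\log x-(1-x)\log(1-x)$, let $\delta_{GV}(r)\in[0,1/2]$ be defined for $0\le r\le 1$ by $r=1-h_2(\delta_{GV}(r))$, let $R^*=1-h_2\!\left(\frac{2\alpha}{1+2\alpha}\right)$, and let $$E_{\rm ex}^{\rm BSC}(r)=\begin{cases}\log\frac{2}{1+2\alpha}-r, & r\ge R^*,\\ -\delta_{GV}(r)\log(2\alpha), & 0\le r\le R^*,\end{cases}$$ be the expurgated exponent of the binary symmetric channel with crossover probability $\epsilon$.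 (1) For every $R>\log(q/2)$, $$E(R)\ \ge\ E_{\rm ex}^{\rm BSC}\bigl(R-\log(q/2)\bigr).$$ (2) Let $\log(q/2)<R\le\log q$ and $r=R-\log(q/2)$. There are binary linear codes $C_{2,n}\subseteq\{0,1\}^n$ with $\frac1n\dim C_{2,n}\to r$ such that, for $1\le z\le n$, the number $B_z$ of words of $C_{2,n}$ of Hamming weight $z$ is $0$ if $z<\delta_{GV}(r)\,n$ and is always at most $2^{n(r-1+h_2(z/n)+o(1))}$, with $o(1)$ uniform in $z$, and such that the codes $C_n=\{0,2,\dots,q-2\}^n+C_{2,n}\subseteq\mathbb{Z}_q^n$ satisfy $\frac1n\log|C_n|\to R$ and, for the maximal error probability $P_e(C_n)$ of $C_n$ under its best decoder, $\liminf_{n}\frac1n\log\frac1{P_e(C_n)}\ge E_{\rm ex}^{\rm BSC}(r)$. (3) Let $E_{\rm ex}^\infty(R)=\sup_{k\ge1}\sup_{\rho\ge1}\bigl[-\frac{\rho}{k}\log\min_{P}\sum_{x,x'\in\mathbb{Z}_q^k}P(x)P(x')g_k(x,x')^{1/\rho}-\rho R\bigr]$ be the multiletter expurgated exponent of $W$,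 where $P$ runs over the probability distributions on $\mathbb{Z}_q^k$ and $g_k(x,x')=\sum_{y}\sqrt{W^k(y|x)W^k(y|x')}$. If $\epsilon<1/2$, then $R^*>0$ and $$E_{\rm ex}^\infty(R)<E_{\rm ex}^{\rm BSC}\bigl(R-\log(q/2)\bigr)\qquad\text{for } \log(q/2)<R<\log(q/2)+R^*.$$ Moreover, if $\epsilon<1/2$, it is false that $E(R)=E_{\rm ex}^\infty(R)$ for all positive rates $R$ below the critical rate $R_{\rm crit}=\log q-h_2\!\left(\frac{\sqrt\epsilon}{\sqrt\epsilon+\sqrt{1-\epsilon}}\right)$; in particular the Shannon–Gallager–Berlekamp conjecture fails for $q=4$. -/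

import Mathlib

open Filter Topology

noncomputable section

namespace Typewriter

/-! Discrete memoryless channels. `W x y` is the probability of output `y` given input `x`. -/

section Channel

variable {X Y : Type} [Fintype X] [Fintype Y]

/-- The `n`-fold memoryless extension of a channel. -/
def memoryless (W : X → Y → ℝ) (n : ℕ) (x : Fin n → X) (y : Fin n → Y) : ℝ :=
  ∏ i, W (x i) (y i)

/-- Probability that the decoder `dec` does not return `m` when the codeword of `m` is sent. -/
def errorGiven (W : X → Y → ℝ) {n : ℕ} {ι : Type} [DecidableEq ι]
    (enc : ι → Fin n → X) (dec : (Fin n → Y) → ι) (m : ι) : ℝ :=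
  ∑ y, if dec y = m then 0 else memoryless W n (enc m) y

/-- Average probability of error of a code, with the best decoder for it. -/
def avgError (W : X → Y → ℝ) {n : ℕ} {ι : Type} [Fintype ι] [DecidableEq ι]
    (enc : ι → Fin n → X) : ℝ :=
  ⨅ dec : (Fin n → Y) → ι, (∑ m, errorGiven W enc dec m) / (Fintype.card ι : ℝ)

/-- Maximal probability of error of a code, with the best decoder for it. -/
def maxError (W : X → Y → ℝ) {n : ℕ} {ι : Type} [DecidableEq ι]
    (enc : ι → Fin n → X) : ℝ :=
  ⨅ dec : (Fin n → Y) → ι, ⨆ m, errorGiven W enc dec m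

/-- Smallest average probability of error of codes with `M` codewords of length `n`. -/
def optAvgError (W : X → Y → ℝ) (M n : ℕ) : ℝ :=
  ⨅ enc : Fin M → Fin n → X, avgError W enc

/-- Smallest maximal probability of error of codes with `M` codewords of length `n`. -/
def optMaxError (W : X → Y → ℝ) (M n : ℕ) : ℝ :=
  ⨅ enc : Fin M → Fin n → X, maxError W enc

/-- `(1/n) log₂ (1/p)`, with value `∞` at `p = 0`. -/
def expo (n : ℕ) (p : ℝ) : EReal :=
  if p = 0 then ⊤ else ((1 / (n : ℝ) * Real.logb 2 (1 / p) : ℝ) : EReal)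

/-- The reliability function at rate `R` (bits per channel use), for the average error. -/
def reliabilityAvg (W : X → Y → ℝ) (R : ℝ) : EReal :=
  limsup (fun n : ℕ => expo n (optAvgError W ⌈(2 : ℝ) ^ ((n : ℝ) * R)⌉₊ n)) atTop

/-- The reliability function at rate `R` (bits per channel use), for the maximal error. -/
def reliabilityMax (W : X → Y → ℝ) (R : ℝ) : EReal :=
  limsup (fun n : ℕ => expo n (optMaxError W ⌈(2 : ℝ) ^ ((n : ℝ) * R)⌉₊ n)) atTop

/-- The Bhattacharyya coefficient `g_k(x₁, x₂)`. -/
def bhatt (W : X → Y → ℝ) (k : ℕ) (x₁ x₂ : Fin k → X) : ℝ :=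
  ∑ y, Real.sqrt (memoryless W k x₁ y * memoryless W k x₂ y)

/-- The quadratic form `Q^k(ρ, P)`. -/
def quadForm (W : X → Y → ℝ) (k : ℕ) (ρ : ℝ) (P : (Fin k → X) → ℝ) : ℝ :=
  ∑ x₁, ∑ x₂, P x₁ * P x₂ * bhatt W k x₁ x₂ ^ (1 / ρ)

/-- `E_x^k(ρ)`; the minimum is over all probability distributions on `X^k`. -/
def expurgatedX (W : X → Y → ℝ) (k : ℕ) (ρ : ℝ) : ℝ :=
  -(ρ / k) * Real.logb 2 (sInf (quadForm W k ρ '' stdSimplex ℝ (Fin k → X)))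

/-- The `k`-letter expurgated exponent `E_ex^k(R)`. -/
def expurgated (W : X → Y → ℝ) (k : ℕ) (R : ℝ) : EReal :=
  ⨆ ρ : {ρ : ℝ // 1 ≤ ρ}, ((expurgatedX W k ρ - ρ * R : ℝ) : EReal)

/-- The multiletter expurgated exponent `E_ex^∞(R)`. -/
def expurgatedInf (W : X → Y → ℝ) (R : ℝ) : EReal :=
  ⨆ k : {k : ℕ // 1 ≤ k}, expurgated W k R

end Channel

/-- The typewriter channel on `ℤ/q` with crossover probability `ε`. -/
def typewriter (q : ℕ) (ε : ℝ) (x y : ZMod q) : ℝ :=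
  if y = x then 1 - ε else if y = x + 1 then ε else 0

/-- Binary entropy in bits. -/
def h2 (x : ℝ) : ℝ := -x * Real.logb 2 x - (1 - x) * Real.logb 2 (1 - x)

/-- `α_ε = √(ε(1-ε))`. -/
def alpha (ε : ℝ) : ℝ := Real.sqrt (ε * (1 - ε))

/-- The Gilbert–Varshamov relative distance for binary codes: for `0 ≤ r ≤ 1` the set below has
exactly one element, so this is the `δ ∈ [0, 1/2]` with `r = 1 - h₂(δ)`. -/
def deltaGV (r : ℝ) : ℝ := sInf {δ | δ ∈ Set.Icc (0 : ℝ) (1 / 2) ∧ r = 1 - h2 δ}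

/-- The rate at which the expurgated exponent of the BSC leaves its straight line. -/
def rateExBSC (ε : ℝ) : ℝ := 1 - h2 (2 * alpha ε / (1 + 2 * alpha ε))

/-- The expurgated exponent of the binary symmetric channel. -/
def expurgatedBSC (ε r : ℝ) : ℝ :=
  if rateExBSC ε ≤ r then Real.logb 2 (2 / (1 + 2 * alpha ε)) - r
  else -deltaGV r * Real.logb 2 (2 * alpha ε)

/-- The critical rate of the typewriter channel. -/
def rateCrit (q : ℕ) (ε : ℝ) : ℝ :=
  Real.logb 2 q - h2 (Real.sqrt ε / (Real.sqrt ε + Real.sqrt (1 - ε)))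

/-- The zero-error code `{0, 2, …, q-2}^n` in `(ℤ/q)^n`. -/
def zeroErrorCode (q n : ℕ) : Set (Fin n → ZMod q) := {a | ∀ i, ∃ j < q / 2, a i = (2 * j : ℕ)}

/-- A binary word read as a word in `{0, 1}^n ⊆ (ℤ/q)^n`. -/
def liftWord (q : ℕ) {n : ℕ} (b : Fin n → ZMod 2) : Fin n → ZMod q := fun i => ((b i).val : ZMod q)

open Classical in
/-- The union of the cosets `C⁰ + b` of the zero-error code, for `b` in the binary code `C₂`. -/
def cosetCode (q : ℕ) [NeZero q] {n : ℕ} (C₂ : Submodule (ZMod 2) (Fin n → ZMod 2)) :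
    Finset (Fin n → ZMod q) :=
  Finset.univ.filter fun x => ∃ a ∈ zeroErrorCode q n, ∃ b ∈ C₂, x = a + liftWord q b

/-- The number of codewords of Hamming weight `z` in a binary linear code. -/
def weightCount {n : ℕ} (C₂ : Submodule (ZMod 2) (Fin n → ZMod 2)) (z : ℕ) : ℕ :=
  Set.ncard {b | b ∈ C₂ ∧ hammingNorm b = z}

/-- Gilbert–Varshamov-type spectrum at rate `r`: no nonzero codeword of relative weight below
`δ_GV(r)`, and at most `2^{n(r - 1 + h₂(z/n) + o(1))}` codewords of weight `z`, uniformly in `z`. -/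
def HasGVSpectrum (r : ℝ) (C₂ : ∀ n : ℕ, Submodule (ZMod 2) (Fin n → ZMod 2)) : Prop :=
  ∃ η : ℕ → ℝ, Tendsto η atTop (𝓝 0) ∧ ∀ n z : ℕ, 1 ≤ z → z ≤ n →
    ((z : ℝ) < deltaGV r * n → weightCount (C₂ n) z = 0) ∧
    (weightCount (C₂ n) z : ℝ) ≤ (2 : ℝ) ^ ((n : ℝ) * (r - 1 + h2 ((z : ℝ) / n) + η n))

end Typewriter

end

/-! Two letters share an output only if they differ by `0` or `±1`, so distinct words with the same
parity vector are never confused. A union of cosets of the zero-error code is the preimage of a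
binary code under reduction mod 2 (`mem_cosetCode`). A parity flip in one position has two possible
causes, the neighbours on either side, each with Bhattacharyya coefficient `α`; hence the union
bound is at most the weight enumerator of the binary code at `2α`, the Bhattacharyya parameter of
the binary symmetric channel (`sum_kernel_cosetCode_le`). Linear codes on the Gilbert–Varshamov
bound (`exists_gv_code`) turn this into the expurgated exponent of that channel
(`spectrum_exponent_le`).

For the multiletter exponent, `g_k ^ (1/ρ)` dominates entrywise the tensor power of the kernel with
`1` on the diagonal and `β = min (α^(1/ρ)) (1/2)` beside it. This kernel is positive semidefinite
with constant row sums, so its form is least at the uniform distribution (`le_kernel_form`), which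
gives a bound free of `k` (`expurgatedX_le`). Gibbs' inequality at `δ_GV(r)` compares this bound
with the target (`expurgatedBound_lt`). The gap is strict for `ρ > 1` because the factor `2` stays
outside the power `1/ρ`, and for `ρ = 1` because `δ_GV(r)` exceeds the optimal weight `2α/(1+2α)`.
Compactness in `ρ` preserves the gap under the supremum (`exists_expurgatedBound_le`), and the
interval where it holds meets the rates below the critical one. -/

noncomputable section

namespace Typewriter

/-! ### Binary entropy -/

lemma h2_eq_binEntropy (x : ℝ) : h2 x = Real.binEntropy x / Real.log 2 := by
  simp only [h2, Real.binEntropy, Real.logb, Real.log_inv]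
  ring

lemma log_two_pos : 0 < Real.log 2 := Real.log_pos (by norm_num)

lemma h2_continuous : Continuous h2 := by
  rw [show h2 = fun x => Real.binEntropy x / Real.log 2 from funext h2_eq_binEntropy]
  fun_prop

lemma h2_strictMonoOn : StrictMonoOn h2 (Set.Icc 0 (1 / 2)) := by
  intro a ha b hb hab
  rw [one_div] at ha hb
  rw [h2_eq_binEntropy, h2_eq_binEntropy]
  exact div_lt_div_of_pos_right (Real.binEntropy_strictMonoOn ha hb hab) log_two_pos

lemma h2_zero : h2 0 = 0 := by simp [h2]

lemma h2_half : h2 (1 / 2) = 1 := by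
  rw [h2_eq_binEntropy, one_div, Real.binEntropy_two_inv, div_self log_two_pos.ne']

lemma h2_nonneg {x : ℝ} (h0 : 0 ≤ x) (h1 : x ≤ 1) : 0 ≤ h2 x := by
  rw [h2_eq_binEntropy]
  exact div_nonneg (Real.binEntropy_nonneg h0 h1) log_two_pos.le

lemma h2_lt_one {x : ℝ} (hx : x < 1 / 2) : h2 x < 1 := by
  rw [h2_eq_binEntropy, div_lt_one log_two_pos]
  exact Real.binEntropy_lt_log_two.2 (by rw [← one_div]; exact hx.ne)

/-- Gibbs' inequality for a two-point distribution with odds `x`. -/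
lemma h2_add_mul_logb_lt {t x : ℝ} (h0 : 0 ≤ t) (h1 : t ≤ 1) (hx : 0 < x)
    (hne : t ≠ x / (1 + x)) : h2 t + t * Real.logb 2 x < Real.logb 2 (1 + x) := by
  rw [h2_eq_binEntropy, Real.logb, Real.logb, ← mul_div_assoc, ← add_div]
  refine div_lt_div_of_pos_right ?_ log_two_pos
  rcases h0.eq_or_lt with rfl | h0
  · simpa using Real.log_pos (by linarith : 1 < 1 + x)
  rcases h1.eq_or_lt with rfl | h1
  · simpa using Real.log_lt_log hx (by linarith)
  have h1' : 0 < 1 - t := by linarith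
  have hne' : x / t ≠ 1 / (1 - t) := by
    intro h
    rw [div_eq_div_iff h0.ne' h1'.ne'] at h
    apply hne
    rw [eq_div_iff (by linarith)]
    linarith
  -- Strict Jensen for `log` at the points `x / t` and `1 / (1 - t)` with weights `t` and `1 - t`;
  -- the points coincide only at the excluded `t`.
  have := strictConcaveOn_log_Ioi.2 (Set.mem_Ioi.2 (div_pos hx h0))
    (Set.mem_Ioi.2 (div_pos one_pos h1')) hne' h0 h1' (by ring)
  simp only [smul_eq_mul] at this
  rw [mul_div_cancel₀ _ h0.ne', mul_div_cancel₀ _ h1'.ne', Real.log_div hx.ne' h0.ne',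
    one_div, Real.log_inv, add_comm x] at this
  simp only [Real.binEntropy, Real.log_inv]
  linarith

/-- The equality case of Gibbs' inequality: the tangent to `h2` at `d` has slope minus the log-odds
of `d`. -/
lemma h2_odds {d : ℝ} (h0 : 0 < d) (h1 : d < 1) :
    h2 d + d * Real.logb 2 (d / (1 - d)) = Real.logb 2 (1 + d / (1 - d)) := by
  have h1' : 1 - d ≠ 0 := by linarith
  rw [show 1 + d / (1 - d) = (1 - d)⁻¹ by field_simp; ring, Real.logb_inv,
    Real.logb_div h0.ne' h1', h2]
  ring

lemma odds_prob {x : ℝ} (hx : 0 < x) : x / (1 + x) / (1 - x / (1 + x)) = x := by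
  have : 1 + x ≠ 0 := by positivity
  field_simp
  ring

lemma h2_add_mul_logb_le {t x : ℝ} (h0 : 0 ≤ t) (h1 : t ≤ 1) (hx : 0 < x) :
    h2 t + t * Real.logb 2 x ≤ Real.logb 2 (1 + x) := by
  by_cases h : t = x / (1 + x)
  · have := h2_odds (d := t) (by rw [h]; positivity)
      (by rw [h, div_lt_one (by positivity)]; linarith)
    rw [show t / (1 - t) = x by rw [h, odds_prob hx]] at this
    exact this.le
  · exact (h2_add_mul_logb_lt h0 h1 hx h).le

/-! ### The Gilbert–Varshamov distance -/

lemma deltaGV_spec {r : ℝ} (h0 : 0 ≤ r) (h1 : r ≤ 1) :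
    deltaGV r ∈ Set.Icc (0 : ℝ) (1 / 2) ∧ h2 (deltaGV r) = 1 - r := by
  obtain ⟨d, hd, hdr⟩ : (1 - r) ∈ h2 '' Set.Icc 0 (1 / 2) := by
    apply intermediate_value_Icc (by norm_num) h2_continuous.continuousOn
    rw [h2_zero, h2_half]
    constructor <;> linarith
  have : {δ | δ ∈ Set.Icc (0 : ℝ) (1 / 2) ∧ r = 1 - h2 δ} = {d} := by
    ext e
    constructor
    · rintro ⟨he, her⟩
      exact h2_strictMonoOn.injOn he hd (by linarith)
    · rintro rfl
      exact ⟨hd, by linarith⟩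
  rw [deltaGV, this, csInf_singleton]
  exact ⟨hd, hdr⟩

lemma lt_deltaGV {r d : ℝ} (h0 : 0 ≤ r) (h1 : r ≤ 1) (hd : d ∈ Set.Icc (0 : ℝ) (1 / 2))
    (h : h2 d < 1 - r) : d < deltaGV r := by
  obtain ⟨h3, h4⟩ := deltaGV_spec h0 h1
  rw [← h4] at h
  exact (h2_strictMonoOn.lt_iff_lt hd h3).1 h

/-! ### The expurgated exponent of the binary symmetric channel -/

lemma alpha_pos {ε : ℝ} (h0 : 0 < ε) (h1 : ε ≤ 1 / 2) : 0 < alpha ε :=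
  Real.sqrt_pos.2 (mul_pos h0 (by linarith))

lemma alpha_le_half {ε : ℝ} : alpha ε ≤ 1 / 2 :=
  Real.sqrt_le_iff.2 ⟨by norm_num, by nlinarith [sq_nonneg (ε - 1 / 2)]⟩

lemma alpha_lt_half {ε : ℝ} (h1 : ε < 1 / 2) : alpha ε < 1 / 2 :=
  (Real.sqrt_lt' (by norm_num)).2 (by nlinarith [sq_pos_of_pos (sub_pos.2 h1)])

lemma exBSC_prob_mem {ε : ℝ} (h0 : 0 < ε) (h1 : ε ≤ 1 / 2) :
    2 * alpha ε / (1 + 2 * alpha ε) ∈ Set.Icc (0 : ℝ) (1 / 2) := by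
  have := alpha_pos h0 h1
  have h2 := alpha_le_half (ε := ε)
  refine ⟨by positivity, ?_⟩
  rw [div_le_div_iff₀ (by positivity) (by norm_num)]
  linarith

lemma rateExBSC_le_one {ε : ℝ} (h0 : 0 < ε) (h1 : ε ≤ 1 / 2) : rateExBSC ε ≤ 1 := by
  have h := exBSC_prob_mem h0 h1
  have := h2_nonneg h.1 (by linarith [h.2])
  unfold rateExBSC
  linarith

lemma rateExBSC_pos {ε : ℝ} (h0 : 0 < ε) (h1 : ε < 1 / 2) : 0 < rateExBSC ε := by
  have ha := alpha_pos h0 h1.le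
  have hb := alpha_lt_half h1
  have : 2 * alpha ε / (1 + 2 * alpha ε) < 1 / 2 := by
    rw [div_lt_div_iff₀ (by positivity) (by norm_num)]
    linarith
  have := h2_lt_one this
  unfold rateExBSC
  linarith

/-- The left side maximises `h2 t + t log (2α)`. Below `R*` it is not an admissible relative weight,
so the minimum weight dominates the union bound. -/
lemma exBSC_prob_lt_deltaGV {ε r : ℝ} (h0 : 0 < ε) (h1 : ε ≤ 1 / 2) (hr0 : 0 ≤ r)
    (hr : r < rateExBSC ε) : 2 * alpha ε / (1 + 2 * alpha ε) < deltaGV r := by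
  apply lt_deltaGV hr0 (hr.le.trans (rateExBSC_le_one h0 h1)) (exBSC_prob_mem h0 h1)
  unfold rateExBSC at hr
  linarith

lemma logb_two_div {x : ℝ} (hx : 0 < x) : Real.logb 2 (2 / x) = 1 - Real.logb 2 x := by
  rw [Real.logb_div (by norm_num) hx.ne', Real.logb_self_eq_one (by norm_num)]

/-- Every weight allowed by the Gilbert–Varshamov spectrum contributes at most
`2 ^ (-n E)` to the union bound. -/
lemma spectrum_exponent_le {ε r t : ℝ} (h0 : 0 < ε) (h1 : ε ≤ 1 / 2) (hr0 : 0 ≤ r) (hr1 : r ≤ 1)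
    (ht : deltaGV r ≤ t) (ht1 : t ≤ 1) :
    r - 1 + h2 t + t * Real.logb 2 (2 * alpha ε) ≤ -expurgatedBSC ε r := by
  have ha := alpha_pos h0 h1
  obtain ⟨hd, hdr⟩ := deltaGV_spec hr0 hr1
  have ht0 : 0 ≤ t := hd.1.trans ht
  unfold expurgatedBSC
  split_ifs with h
  · rw [logb_two_div (by positivity)]
    linarith [h2_add_mul_logb_le ht0 ht1 (by positivity : 0 < 2 * alpha ε)]
  · have hlt := exBSC_prob_lt_deltaGV h0 h1 hr0 (not_le.1 h)
    have hd0 : 0 < deltaGV r := (exBSC_prob_mem h0 h1).1.trans_lt hlt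
    have hd1 : 0 < 1 - deltaGV r := by linarith [hd.2]
    -- Past the maximiser the tangent to `h2` at `deltaGV r` is steep enough that adding `t log
    -- (2α)` cannot increase the value to the right of `deltaGV r`.
    have hodds : 2 * alpha ε ≤ deltaGV r / (1 - deltaGV r) := by
      rw [le_div_iff₀ hd1]
      rw [div_lt_iff₀ (by positivity)] at hlt
      linarith
    have hlog := Real.logb_le_logb_of_le (by norm_num : (1 : ℝ) < 2) (by positivity) hodds
    have e1 := h2_odds hd0 (by linarith)
    have e2 := h2_add_mul_logb_le ht0 ht1 (div_pos hd0 hd1)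
    nlinarith [mul_le_mul_of_nonneg_left hlog (sub_nonneg.2 ht)]

/-- Lower semicontinuity from the right of the expurgated exponent. -/
lemma exists_expurgatedBSC_gt {ε r c : ℝ} (h0 : 0 < ε) (h1 : ε ≤ 1 / 2) (hr0 : 0 < r)
    (hr1 : r < 1) (hc : c < expurgatedBSC ε r) :
    ∃ r', r < r' ∧ r' ≤ 1 ∧ c < expurgatedBSC ε r' := by
  have ha := alpha_pos h0 h1
  by_cases h : rateExBSC ε ≤ r
  · rw [expurgatedBSC, if_pos h] at hc
    -- On the line of slope `-1`, moving right by half the slack costs at most half the slack.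
    refine ⟨min 1 (r + (Real.logb 2 (2 / (1 + 2 * alpha ε)) - r - c) / 2), ?_, min_le_left _ _, ?_⟩
    · exact lt_min hr1 (by linarith)
    · have hlt : r ≤ min 1 (r + (Real.logb 2 (2 / (1 + 2 * alpha ε)) - r - c) / 2) :=
        le_min hr1.le (by linarith)
      rw [expurgatedBSC, if_pos (h.trans hlt)]
      linarith [min_le_right 1 (r + (Real.logb 2 (2 / (1 + 2 * alpha ε)) - r - c) / 2)]
  · have hc' := hc
    rw [expurgatedBSC, if_neg h] at hc
    rw [not_le] at h
    obtain ⟨hd, hdr⟩ := deltaGV_spec hr0.le hr1.le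
    have hlt := exBSC_prob_lt_deltaGV h0 h1 hr0.le h
    have hd0 : 0 < deltaGV r := (exBSC_prob_mem h0 h1).1.trans_lt hlt
    -- A distance `d` slightly below `deltaGV r` still beats `c`, and any `r'` with `h2 d < 1 - r'`
    -- has `d < deltaGV r'`; continuity of `deltaGV` is not needed.
    obtain ⟨d, hdd, hd0', hcd⟩ : ∃ d, d < deltaGV r ∧ 0 ≤ d ∧
        c < -d * Real.logb 2 (2 * alpha ε) := by
      have hcont : Continuous fun d : ℝ => -d * Real.logb 2 (2 * alpha ε) := by fun_prop
      have hev := (hcont.continuousAt (x := deltaGV r)).eventually (lt_mem_nhds hc)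
      have hev2 := hev.and (lt_mem_nhds hd0)
      obtain ⟨d, hd1, hd2⟩ := ((hev2.filter_mono (nhdsWithin_le_nhds (s := Set.Iio (deltaGV r)))).and
        self_mem_nhdsWithin).exists
      exact ⟨d, hd2, hd1.2.le, hd1.1⟩
    have hdI : d ∈ Set.Icc (0 : ℝ) (1 / 2) := ⟨hd0', hdd.le.trans hd.2⟩
    have hm : h2 d < 1 - r := by rw [← hdr]; exact h2_strictMonoOn hdI hd hdd
    obtain ⟨r', hr', hr2⟩ := exists_between (lt_min h (by linarith : r < 1 - h2 d))
    have hb := lt_of_lt_of_le hr2 (min_le_left _ _)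
    have hr1' : r' ≤ 1 := hb.le.trans (rateExBSC_le_one h0 h1)
    refine ⟨r', hr', hr1', ?_⟩
    rw [expurgatedBSC, if_neg (not_le.2 hb)]
    have : d < deltaGV r' := lt_deltaGV (by linarith) hr1' hdI
      (by linarith [lt_of_lt_of_le hr2 (min_le_right _ _)])
    have hl : Real.logb 2 (2 * alpha ε) ≤ 0 :=
      Real.logb_nonpos (by norm_num) (by positivity) (by linarith [alpha_le_half (ε := ε)])
    nlinarith

/-- Makes the reliability bound trivial from rate `log q` on, where no larger binary rate is left to
use. -/
lemma expurgatedBSC_nonpos {ε r : ℝ} (h0 : 0 < ε) (h1 : ε ≤ 1 / 2) (hr : 1 ≤ r) :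
    expurgatedBSC ε r ≤ 0 := by
  have ha := alpha_pos h0 h1
  rw [expurgatedBSC, if_pos ((rateExBSC_le_one h0 h1).trans hr), logb_two_div (by positivity)]
  linarith [Real.logb_nonneg (by norm_num : (1 : ℝ) < 2) (by linarith : 1 ≤ 1 + 2 * alpha ε)]

/-! ### Binary linear codes -/

section Greedy

variable {V : Type*} [AddCommGroup V] [Module (ZMod 2) V] [Fintype V]

open Classical in
/-- Total weight of the nonzero words of a linear code. -/
def codeMass (w : V → ℝ) (C : Submodule (ZMod 2) V) : ℝ :=
  ∑ b, if b ∈ C ∧ b ≠ 0 then w b else 0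

lemma codeMass_eq_sum_filter (w : V → ℝ) (C : Submodule (ZMod 2) V)
    [DecidablePred fun b => b ∈ C ∧ b ≠ 0] :
    codeMass w C = ∑ b ∈ Finset.univ.filter (fun b => b ∈ C ∧ b ≠ 0), w b := by
  rw [Finset.sum_filter]
  exact Finset.sum_congr rfl fun b _ => by congr

-- Averaging over the adjoined vector: summed over all `v`, the cosets `C + v` carry mass `|C|`
-- times the total, and at least half of all `v` lie outside the proper subspace `C`, so some such
-- `v` adds little.
open Classical in
lemma exists_codeMass_step (w : V → ℝ) (hw : ∀ v, 0 ≤ w v) (C : Submodule (ZMod 2) V)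
    (hC : Module.finrank (ZMod 2) C < Module.finrank (ZMod 2) V) :
    ∃ C' : Submodule (ZMod 2) V,
      Module.finrank (ZMod 2) C' = Module.finrank (ZMod 2) C + 1 ∧
      (2 : ℝ) ^ Module.finrank (ZMod 2) V * codeMass w C' ≤
        (2 : ℝ) ^ Module.finrank (ZMod 2) V * codeMass w C +
          2 ^ (Module.finrank (ZMod 2) C + 1) * ∑ v, w v := by
  set n := Module.finrank (ZMod 2) V
  set j := Module.finrank (ZMod 2) C
  have hcardC : (Finset.univ.filter (· ∈ C)).card = 2 ^ j := by
    rw [← Fintype.card_subtype, Module.card_eq_pow_finrank (K := ZMod 2) (V := C), ZMod.card]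
  have hcardV : Fintype.card V = 2 ^ n := by
    rw [Module.card_eq_pow_finrank (K := ZMod 2) (V := V), ZMod.card]
  have hcard : (2 : ℝ) ^ n ≤ 2 * ((Finset.univ.filter (· ∉ C)).card : ℝ) := by
    have h := Finset.card_filter_add_card_filter_not (s := (Finset.univ : Finset V)) (· ∈ C)
    rw [hcardC, Finset.card_univ, hcardV] at h
    have h2 : 2 * 2 ^ j ≤ 2 ^ n := by
      rw [← pow_succ']
      exact Nat.pow_le_pow_right (by norm_num) hC
    have : 2 ^ n ≤ 2 * (Finset.univ.filter (· ∉ C)).card := by omega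
    exact_mod_cast this
  have hpos : (0 : ℝ) < 2 ^ n := by positivity
  have hne : (Finset.univ.filter (· ∉ C)).Nonempty := by
    rw [← Finset.card_pos]
    by_contra h0
    rw [not_lt, Nat.le_zero] at h0
    rw [h0] at hcard
    simp at hcard
    linarith
  set S : ℝ := ∑ v, w v with hS
  have hS0 : 0 ≤ S := Finset.sum_nonneg fun v _ => hw v
  obtain ⟨v, hv, hle⟩ : ∃ v ∈ Finset.univ.filter (· ∉ C),
      ∑ b ∈ Finset.univ.filter (· ∈ C), w (b + v) ≤ 2 ^ (j + 1) * S / 2 ^ n := by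
    apply Finset.exists_le_of_sum_le hne
    rw [Finset.sum_comm]
    calc ∑ b ∈ Finset.univ.filter (· ∈ C), ∑ v ∈ Finset.univ.filter (· ∉ C), w (b + v)
        ≤ ∑ b ∈ Finset.univ.filter (· ∈ C), S := by
          refine Finset.sum_le_sum fun b _ => ?_
          calc ∑ v ∈ Finset.univ.filter (· ∉ C), w (b + v) ≤ ∑ v, w (b + v) :=
                Finset.sum_le_sum_of_subset_of_nonneg (Finset.filter_subset _ _)
                  fun v _ _ => hw _
            _ = S := Equiv.sum_comp (Equiv.addLeft b) w
      _ = 2 ^ j * S := by rw [Finset.sum_const, hcardC]; simp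
      _ ≤ ∑ v ∈ Finset.univ.filter (· ∉ C), 2 ^ (j + 1) * S / 2 ^ n := by
          rw [Finset.sum_const, nsmul_eq_mul, mul_div_assoc', le_div_iff₀ hpos]
          have := mul_le_mul_of_nonneg_left hcard (by positivity : 0 ≤ 2 ^ j * S)
          rw [pow_succ]
          linarith
  rw [Finset.mem_filter] at hv
  refine ⟨C ⊔ Submodule.span (ZMod 2) {v}, Submodule.finrank_sup_span_singleton hv.2, ?_⟩
  have hmass : codeMass w (C ⊔ Submodule.span (ZMod 2) {v}) ≤
      codeMass w C + ∑ b ∈ Finset.univ.filter (· ∈ C), w (b + v) := by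
    have e : ∑ b ∈ Finset.univ.filter (· ∈ C), w (b + v) =
        ∑ b, if b - v ∈ C then w b else 0 := by
      rw [Finset.sum_filter, ← Equiv.sum_comp (Equiv.addRight v)
        (fun b => if b - v ∈ C then w b else 0)]
      simp
    rw [e, codeMass, codeMass, ← Finset.sum_add_distrib]
    refine Finset.sum_le_sum fun b _ => ?_
    by_cases hb : b ∈ C ⊔ Submodule.span (ZMod 2) {v} ∧ b ≠ 0
    · rw [if_pos hb]
      obtain ⟨c, hc, d, hd, hcd⟩ := Submodule.mem_sup.1 hb.1
      obtain ⟨a, rfl⟩ := Submodule.mem_span_singleton.1 hd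
      -- Over two scalars, the enlarged code is just `C ∪ (C + v)`.
      have ha : a = 0 ∨ a = 1 := by
        clear hcd hd
        revert a
        decide
      rcases ha with rfl | rfl
      · rw [zero_smul, add_zero] at hcd
        rw [if_pos ⟨hcd ▸ hc, hb.2⟩]
        split_ifs
        · linarith [hw b]
        · linarith
      · rw [one_smul] at hcd
        have : b - v ∈ C := by rw [← hcd, add_sub_cancel_right]; exact hc
        rw [if_pos this]
        split_ifs
        · linarith [hw b]
        · linarith
    · rw [if_neg hb]
      have := hw b
      split_ifs <;> linarith
  rw [le_div_iff₀ hpos] at hle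
  nlinarith

/-- Greedy extension from the zero code; the increments double at each step, so their sum is below
twice the last one. -/
lemma exists_codeMass_le (w : V → ℝ) (hw : ∀ v, 0 ≤ w v) (k : ℕ)
    (hk : k ≤ Module.finrank (ZMod 2) V) :
    ∃ C : Submodule (ZMod 2) V, Module.finrank (ZMod 2) C = k ∧
      (2 : ℝ) ^ Module.finrank (ZMod 2) V * codeMass w C ≤ 2 ^ (k + 1) * ∑ v, w v := by
  have hS0 : 0 ≤ ∑ v, w v := Finset.sum_nonneg fun v _ => hw v
  induction k with
  | zero =>
    refine ⟨⊥, by simp, ?_⟩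
    have : codeMass w (⊥ : Submodule (ZMod 2) V) = 0 := by
      refine Finset.sum_eq_zero fun b _ => if_neg ?_
      rw [Submodule.mem_bot]
      tauto
    rw [this, mul_zero]
    positivity
  | succ k ih =>
    obtain ⟨C, hC, hm⟩ := ih (by omega)
    obtain ⟨C', hC', hm'⟩ := exists_codeMass_step w hw C (by omega)
    refine ⟨C', by omega, hm'.trans ?_⟩
    rw [hC]
    calc _ ≤ 2 ^ (k + 1) * ∑ v, w v + 2 ^ (k + 1) * ∑ v, w v := by gcongr
      _ = _ := by ring

end Greedy

/-! ### Words of given weight, and codes with nearly average weight distribution. -/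

open Classical in
/-- The number of binary words of length `n` and weight `z`. -/
def wordCount (n z : ℕ) : ℕ :=
  (Finset.univ.filter fun b : Fin n → ZMod 2 => hammingNorm b = z).card

lemma sum_prod_eq_zero_ite (n : ℕ) (c d : ℝ) :
    ∑ b : Fin n → ZMod 2, ∏ i, (if b i = 0 then c else d) = (c + d) ^ n := by
  have := (Finset.prod_univ_sum (fun _ : Fin n => (Finset.univ : Finset (ZMod 2)))
    (fun _ a => if a = 0 then c else d)).symm
  rw [Fintype.piFinset_univ] at this
  rw [this]
  have h : ∑ a : ZMod 2, (if a = 0 then c else d) = c + d := by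
    rw [show (Finset.univ : Finset (ZMod 2)) = {0, 1} from rfl]
    simp
  simp [h]

lemma prod_eq_zero_ite {n : ℕ} (b : Fin n → ZMod 2) (c d : ℝ) :
    ∏ i, (if b i = 0 then c else d) = c ^ (n - hammingNorm b) * d ^ hammingNorm b := by
  classical
  rw [Finset.prod_ite, Finset.prod_const, Finset.prod_const]
  have h := Finset.card_filter_add_card_filter_not (s := (Finset.univ : Finset (Fin n)))
    (fun i => b i = 0)
  rw [Finset.card_univ, Fintype.card_fin] at h
  have h2 : hammingNorm b = (Finset.univ.filter fun i => ¬ b i = 0).card := rfl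
  rw [h2, show n - (Finset.univ.filter fun i => ¬ b i = 0).card =
    (Finset.univ.filter fun i => b i = 0).card by omega]

/-- With i.i.d. bits of bias `z / n`, each word of weight `z` has probability `2 ^ (-n h2(z/n))`,
and these probabilities sum to at most `1`. -/
lemma wordCount_le {n z : ℕ} (hz : 1 ≤ z) (hzn : z ≤ n) :
    (wordCount n z : ℝ) ≤ (2 : ℝ) ^ ((n : ℝ) * h2 ((z : ℝ) / n)) := by
  classical
  have hn : (0 : ℝ) < n := by exact_mod_cast (by omega : 0 < n)
  have hz0 : (0 : ℝ) < z := by exact_mod_cast hz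
  set p : ℝ := z / n with hp
  have hp0 : 0 < p := div_pos hz0 hn
  have hp1 : p ≤ 1 := (div_le_one hn).2 (by exact_mod_cast hzn)
  have hsum : (wordCount n z : ℝ) * ((1 - p) ^ (n - z) * p ^ z) ≤ 1 := by
    have h1 := sum_prod_eq_zero_ite n (1 - p) p
    rw [sub_add_cancel, one_pow] at h1
    rw [wordCount, ← nsmul_eq_mul, ← Finset.sum_const]
    calc _ = ∑ b ∈ Finset.univ.filter (fun b : Fin n → ZMod 2 => hammingNorm b = z),
          ∏ i, (if b i = 0 then 1 - p else p) := by
          refine Finset.sum_congr rfl fun b hb => ?_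
          rw [prod_eq_zero_ite, (Finset.mem_filter.1 hb).2]
      _ ≤ ∑ b : Fin n → ZMod 2, ∏ i, (if b i = 0 then 1 - p else p) :=
          Finset.sum_le_sum_of_subset_of_nonneg (Finset.filter_subset _ _) fun b _ _ =>
            Finset.prod_nonneg fun i _ => by split_ifs <;> linarith
      _ = 1 := h1
  have hval : ((1 - p) ^ (n - z) * p ^ z) = (2 : ℝ) ^ (-((n : ℝ) * h2 p)) := by
    have e1 : p ^ z = (2 : ℝ) ^ (z * Real.logb 2 p) := by
      rw [mul_comm, Real.rpow_mul (by norm_num), Real.rpow_logb (by norm_num) (by norm_num) hp0,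
        Real.rpow_natCast]
    have e2 : (1 - p) ^ (n - z) = (2 : ℝ) ^ ((n - z : ℝ) * Real.logb 2 (1 - p)) := by
      -- At `z = n` the base `1 - p` vanishes, but so does its exponent on both sides.
      rcases hzn.eq_or_lt with h | h
      · subst h
        simp
      · have : 0 < 1 - p := by
          rw [sub_pos, hp, div_lt_one hn]
          exact_mod_cast h
        rw [mul_comm, Real.rpow_mul (by norm_num), Real.rpow_logb (by norm_num) (by norm_num) this,
          ← Nat.cast_sub hzn, Real.rpow_natCast]
    rw [e1, e2, ← Real.rpow_add (by norm_num)]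
    congr 1
    have : (z : ℝ) = n * p := by rw [hp]; field_simp
    rw [h2, this]
    ring
  rw [hval, Real.rpow_neg (by norm_num), ← div_eq_mul_inv, div_le_one (by positivity)] at hsum
  exact hsum

/-- A linear code of any given dimension whose weight distribution is at most `2(n+1)` times the
average one. -/
lemma exists_code_weightCount_le (n k : ℕ) (hk : k ≤ n) :
    ∃ C : Submodule (ZMod 2) (Fin n → ZMod 2), Module.finrank (ZMod 2) C = k ∧
      ∀ z, 1 ≤ z → (2 : ℝ) ^ n * weightCount C z ≤ 2 ^ (k + 1) * (n + 1) * wordCount n z := by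
  classical
  -- With these weights each weight class has total mass at most `1`, so a single mass bound
  -- controls every `z` at once at the cost of a factor `n + 1`.
  set w : (Fin n → ZMod 2) → ℝ := fun b => (wordCount n (hammingNorm b) : ℝ)⁻¹ with hw
  obtain ⟨C, hC, hm⟩ := exists_codeMass_le w (fun v => by positivity) k (by simpa using hk)
  refine ⟨C, hC, fun z hz => ?_⟩
  rw [Module.finrank_fin_fun] at hm
  have hT : ∑ b, w b ≤ n + 1 := by
    rw [← Finset.sum_fiberwise_of_maps_to (g := fun b : Fin n → ZMod 2 => hammingNorm b)
      (t := Finset.range (n + 1))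
      (fun b _ => by
        have := hammingNorm_le_card_fintype (x := b)
        rw [Fintype.card_fin] at this
        exact Finset.mem_range.2 (by omega))]
    calc _ ≤ ∑ j ∈ Finset.range (n + 1), (1 : ℝ) := by
          refine Finset.sum_le_sum fun j _ => ?_
          rw [Finset.sum_congr rfl (g := fun _ => (wordCount n j : ℝ)⁻¹)
            (fun b hb => by rw [hw]; simp only; rw [(Finset.mem_filter.1 hb).2]),
            Finset.sum_const, nsmul_eq_mul]
          have e : (Finset.univ.filter fun b : Fin n → ZMod 2 => hammingNorm b = j).card =
            wordCount n j := by rw [wordCount]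
          rw [e]
          exact mul_inv_le_one
      _ = n + 1 := by simp
  have hmass : (weightCount C z : ℝ) * (wordCount n z : ℝ)⁻¹ ≤ codeMass w C := by
    have e : weightCount C z =
        (Finset.univ.filter fun b : Fin n → ZMod 2 => b ∈ C ∧ hammingNorm b = z).card := by
      rw [weightCount, ← Set.ncard_coe_finset]
      simp
    rw [e, ← nsmul_eq_mul, ← Finset.sum_const, Finset.sum_filter, codeMass]
    refine Finset.sum_le_sum fun b _ => ?_
    by_cases h : b ∈ C ∧ hammingNorm b = z
    · have hb : b ≠ 0 := by
        rintro rfl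
        rw [hammingNorm_zero] at h
        omega
      rw [if_pos h, if_pos ⟨h.1, hb⟩, hw]
      simp only
      rw [h.2]
    · rw [if_neg h]
      split_ifs
      · rw [hw]; positivity
      · exact le_rfl
  have hle : weightCount C z ≤ wordCount n z := by
    rw [weightCount, wordCount, ← Set.ncard_coe_finset]
    refine Set.ncard_le_ncard ?_ (Set.toFinite _)
    intro b hb
    simpa using hb.2
  rcases Nat.eq_zero_or_pos (wordCount n z) with h0 | h0
  · rw [h0, Nat.le_zero] at hle
    simp [hle, h0]
  · have hN : (0 : ℝ) < wordCount n z := by exact_mod_cast h0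
    have h1 : (2 : ℝ) ^ n * (weightCount C z * (wordCount n z : ℝ)⁻¹) ≤ 2 ^ (k + 1) * (n + 1) :=
      calc _ ≤ (2 : ℝ) ^ n * codeMass w C := by gcongr
        _ ≤ _ := hm
        _ ≤ _ := by gcongr
    rwa [← mul_assoc, ← div_eq_mul_inv, div_le_iff₀ hN] at h1

/-! ### Linear codes with Gilbert–Varshamov spectrum. -/

/-- Dimension of the codes below: slightly less than `n r`. -/
def gvDim (r : ℝ) (n : ℕ) : ℕ := ⌊(n : ℝ) * r - Real.logb 2 (4 * (n + 1))⌋₊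

lemma gvDim_le {r : ℝ} (hr0 : 0 ≤ r) (n : ℕ) : (gvDim r n : ℝ) ≤ n * r := by
  rcases Nat.eq_zero_or_pos (gvDim r n) with h | h
  · rw [h, Nat.cast_zero]
    positivity
  · have h1 := Nat.floor_le (Nat.pos_of_floor_pos h).le
    have h2 : 0 ≤ Real.logb 2 (4 * ((n : ℝ) + 1)) :=
      Real.logb_nonneg (by norm_num) (by linarith [(Nat.cast_nonneg n : (0 : ℝ) ≤ n)])
    exact h1.trans (by linarith)

lemma tendsto_logb_div : Tendsto (fun n : ℕ => Real.logb 2 (4 * ((n : ℝ) + 1)) / n) atTop (𝓝 0) := by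
  have hu : Tendsto (fun n : ℕ => 4 * ((n : ℝ) + 1)) atTop atTop :=
    (tendsto_natCast_atTop_atTop.atTop_add tendsto_const_nhds).const_mul_atTop (by norm_num)
  have h1 : Tendsto (fun x : ℝ => Real.logb 2 x / x) atTop (𝓝 0) :=
    Real.isLittleO_logb_id_atTop.tendsto_div_nhds_zero
  have h2 : Tendsto (fun n : ℕ => 4 + 4 * (1 / (n : ℝ))) atTop (𝓝 (4 + 4 * 0)) :=
    tendsto_const_nhds.add (tendsto_one_div_atTop_nhds_zero_nat.const_mul 4)
  have h3 := (h1.comp hu).mul h2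
  rw [zero_mul] at h3
  refine h3.congr' ?_
  filter_upwards [eventually_gt_atTop 0] with n hn
  have hn' : (n : ℝ) ≠ 0 := by exact_mod_cast hn.ne'
  simp only [Function.comp]
  field_simp

lemma tendsto_gvDim {r : ℝ} (hr0 : 0 ≤ r) :
    Tendsto (fun n : ℕ => (gvDim r n : ℝ) / n) atTop (𝓝 r) := by
  have hl : Tendsto (fun n : ℕ => r - Real.logb 2 (4 * ((n : ℝ) + 1)) / n - 1 / (n : ℝ)) atTop
      (𝓝 (r - 0 - 0)) :=
    (tendsto_const_nhds.sub tendsto_logb_div).sub tendsto_one_div_atTop_nhds_zero_nat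
  rw [sub_zero, sub_zero] at hl
  refine tendsto_of_tendsto_of_tendsto_of_le_of_le' hl tendsto_const_nhds ?_ ?_
  · filter_upwards [eventually_gt_atTop 0] with n hn
    have hn' : (0 : ℝ) < n := by exact_mod_cast hn
    have := Nat.lt_floor_add_one ((n : ℝ) * r - Real.logb 2 (4 * (n + 1)))
    rw [le_div_iff₀ hn', sub_mul, sub_mul, div_mul_cancel₀ _ hn'.ne', div_mul_cancel₀ _ hn'.ne']
    unfold gvDim
    linarith
  · filter_upwards [eventually_gt_atTop 0] with n hn
    have hn' : (0 : ℝ) < n := by exact_mod_cast hn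
    rw [div_le_iff₀ hn', mul_comm]
    exact gvDim_le hr0 n

/-- Linear codes on the Gilbert–Varshamov bound. -/
lemma exists_gv_code {r : ℝ} (hr0 : 0 ≤ r) (hr1 : r ≤ 1) (n : ℕ) :
    ∃ C : Submodule (ZMod 2) (Fin n → ZMod 2), Module.finrank (ZMod 2) C = gvDim r n ∧
      ∀ z : ℕ, 1 ≤ z → z ≤ n →
        ((z : ℝ) < deltaGV r * n → weightCount C z = 0) ∧
        (weightCount C z : ℝ) ≤ (2 : ℝ) ^ ((n : ℝ) * (r - 1 + h2 ((z : ℝ) / n))) := by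
  -- Strictness matters: below `deltaGV r` the bound is at most `1`, so a strictly smaller count is
  -- zero.
  suffices H : ∃ C : Submodule (ZMod 2) (Fin n → ZMod 2), Module.finrank (ZMod 2) C = gvDim r n ∧
      ∀ z : ℕ, 1 ≤ z → z ≤ n →
        (weightCount C z : ℝ) < (2 : ℝ) ^ ((n : ℝ) * (r - 1 + h2 ((z : ℝ) / n))) by
    obtain ⟨C, hC, hz⟩ := H
    refine ⟨C, hC, fun z h1 h2' => ⟨fun hlt => ?_, (hz z h1 h2').le⟩⟩
    have hn : (0 : ℝ) < n := by exact_mod_cast (by omega : 0 < n)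
    obtain ⟨hd, hdr⟩ := deltaGV_spec hr0 hr1
    have hzd : (z : ℝ) / n < deltaGV r := by rwa [div_lt_iff₀ hn]
    have hm := h2_strictMonoOn (⟨by positivity, hzd.le.trans hd.2⟩ :
      (z : ℝ) / n ∈ Set.Icc (0 : ℝ) (1 / 2)) hd hzd
    have h1' := hz z h1 h2'
    have : (2 : ℝ) ^ ((n : ℝ) * (r - 1 + h2 ((z : ℝ) / n))) ≤ 1 :=
      Real.rpow_le_one_of_one_le_of_nonpos (by norm_num)
        (mul_nonpos_of_nonneg_of_nonpos hn.le (by linarith))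
    have : (weightCount C z : ℝ) < 1 := h1'.trans_le this
    exact Nat.lt_one_iff.1 (by exact_mod_cast this)
  -- The floor may have truncated a negative number, in which case it gives no bound on `2 ^ gvDim r
  -- n`; the zero code serves instead.
  rcases Nat.eq_zero_or_pos (gvDim r n) with h0 | h0
  · refine ⟨⊥, by rw [h0, finrank_bot], fun z h1 _ => ?_⟩
    have : weightCount (⊥ : Submodule (ZMod 2) (Fin n → ZMod 2)) z = 0 := by
      rw [weightCount, Set.ncard_eq_zero]
      ext b
      simp only [Submodule.mem_bot, Set.mem_ofPred_eq, Set.mem_empty_iff_false, iff_false, not_and]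
      rintro rfl
      rw [hammingNorm_zero]
      omega
    rw [this, Nat.cast_zero]
    positivity
  · have hkn : gvDim r n ≤ n := by
      have := gvDim_le hr0 n
      have h : (gvDim r n : ℝ) ≤ n := this.trans (mul_le_of_le_one_right (by positivity) hr1)
      exact_mod_cast h
    obtain ⟨C, hC, hz⟩ := exists_code_weightCount_le n (gvDim r n) hkn
    refine ⟨C, hC, fun z h1 h2' => ?_⟩
    have hfl := Nat.floor_le (Nat.pos_of_floor_pos h0).le
    -- The dimension given up pays for the factor `2 (n + 1)` of the averaging and leaves a spare
    -- `2`, which yields the strict inequality.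
    have hk : (2 : ℝ) ^ (gvDim r n) * (4 * (n + 1)) ≤ 2 ^ ((n : ℝ) * r) := by
      have := Real.rpow_le_rpow_of_exponent_le (by norm_num : (1 : ℝ) ≤ 2) hfl
      rw [Real.rpow_sub (by norm_num), Real.rpow_logb (by norm_num) (by norm_num) (by positivity),
        le_div_iff₀ (by positivity), Real.rpow_natCast] at this
      exact this
    have hN := wordCount_le h1 h2'
    rw [show (n : ℝ) * (r - 1 + h2 ((z : ℝ) / n)) = n * r - n + n * h2 ((z : ℝ) / n) by ring,
      Real.rpow_add (by norm_num), Real.rpow_sub (by norm_num), Real.rpow_natCast,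
      div_mul_eq_mul_div, lt_div_iff₀ (by positivity)]
    have hP : (0 : ℝ) < 2 ^ ((n : ℝ) * r) * 2 ^ ((n : ℝ) * h2 ((z : ℝ) / n)) := by positivity
    have := hz z h1
    calc (weightCount C z : ℝ) * 2 ^ n ≤ 2 ^ (gvDim r n + 1) * (n + 1) * wordCount n z := by
          linarith
      _ = (2 : ℝ) ^ (gvDim r n) * (4 * (n + 1)) * wordCount n z / 2 := by ring
      _ ≤ 2 ^ ((n : ℝ) * r) * 2 ^ ((n : ℝ) * h2 ((z : ℝ) / n)) / 2 := by gcongr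
      _ < _ := by linarith

/-! ### The Bhattacharyya union bound -/

section UnionBound

variable {X Y : Type} {W : X → Y → ℝ}

lemma memoryless_nonneg (hW : ∀ x y, 0 ≤ W x y) {n : ℕ} (x : Fin n → X) (y : Fin n → Y) :
    0 ≤ memoryless W n x y :=
  Finset.prod_nonneg fun _ _ => hW _ _

variable [Fintype Y]

lemma bhatt_eq_prod (hW : ∀ x y, 0 ≤ W x y) (k : ℕ) (x x' : Fin k → X) :
    bhatt W k x x' = ∏ i, ∑ y, Real.sqrt (W (x i) y * W (x' i) y) := by
  classical
  rw [Finset.prod_univ_sum, Fintype.piFinset_univ, bhatt]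
  refine Finset.sum_congr rfl fun y _ => ?_
  rw [memoryless, memoryless, ← Finset.prod_mul_distrib,
    Real.sqrt_prod _ fun i _ => mul_nonneg (hW _ _) (hW _ _)]

lemma errorGiven_nonneg (hW : ∀ x y, 0 ≤ W x y) {n : ℕ} {ι : Type} [DecidableEq ι]
    (enc : ι → Fin n → X) (dec : (Fin n → Y) → ι) (m : ι) : 0 ≤ errorGiven W enc dec m :=
  Finset.sum_nonneg fun y _ => by
    split_ifs
    · exact le_rfl
    · exact memoryless_nonneg hW _ _

/-- Maximum likelihood decoding meets the Bhattacharyya union bound. -/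
lemma exists_decoder_le (hW : ∀ x y, 0 ≤ W x y) {n : ℕ} {ι : Type} [Fintype ι] [DecidableEq ι]
    [Nonempty ι] (enc : ι → Fin n → X) :
    ∃ dec : (Fin n → Y) → ι, ∀ m,
      errorGiven W enc dec m ≤ ∑ m' ∈ Finset.univ.erase m, bhatt W n (enc m) (enc m') := by
  choose dec hdec using fun y : Fin n → Y =>
    Finite.exists_max fun m : ι => memoryless W n (enc m) y
  refine ⟨dec, fun m => ?_⟩
  unfold bhatt errorGiven
  rw [Finset.sum_comm]
  refine Finset.sum_le_sum fun y _ => ?_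
  split_ifs with h
  · exact Finset.sum_nonneg fun _ _ => Real.sqrt_nonneg _
  -- On a decoding error the decoded word is at least as likely as the sent one, so the likelihood
  -- of the latter is at most their geometric mean, a single term of the union bound.
  · refine le_trans ?_ (Finset.single_le_sum (f := fun m' =>
      Real.sqrt (memoryless W n (enc m) y * memoryless W n (enc m') y))
      (fun _ _ => Real.sqrt_nonneg _) (Finset.mem_erase.2 ⟨h, Finset.mem_univ (dec y)⟩))
    have h0 := memoryless_nonneg hW (enc m) y
    exact Real.le_sqrt_of_sq_le (by rw [sq]; exact mul_le_mul_of_nonneg_left (hdec y m) h0)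

lemma maxError_le {n : ℕ} {ι : Type} [Fintype ι] [DecidableEq ι] [Nonempty ι]
    {enc : ι → Fin n → X} {B : ℝ} {dec : (Fin n → Y) → ι} (h : ∀ m, errorGiven W enc dec m ≤ B) :
    maxError W enc ≤ B :=
  (ciInf_le (Set.finite_range _).bddBelow dec).trans (ciSup_le h)

lemma avgError_le {n : ℕ} {ι : Type} [Fintype ι] [DecidableEq ι] [Nonempty ι]
    {enc : ι → Fin n → X} {B : ℝ} {dec : (Fin n → Y) → ι} (h : ∀ m, errorGiven W enc dec m ≤ B) :
    avgError W enc ≤ B := by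
  refine (ciInf_le (Set.finite_range _).bddBelow dec).trans ?_
  rw [div_le_iff₀ (by exact_mod_cast Fintype.card_pos)]
  calc ∑ m, errorGiven W enc dec m ≤ ∑ _m : ι, B := Finset.sum_le_sum fun m _ => h m
    _ = B * Fintype.card ι := by rw [Finset.sum_const, Finset.card_univ, nsmul_eq_mul, mul_comm]

lemma maxError_nonneg (hW : ∀ x y, 0 ≤ W x y) {n : ℕ} {ι : Type} [DecidableEq ι]
    (enc : ι → Fin n → X) : 0 ≤ maxError W enc :=
  Real.iInf_nonneg fun _ => Real.iSup_nonneg fun _ => errorGiven_nonneg hW _ _ _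

lemma avgError_nonneg (hW : ∀ x y, 0 ≤ W x y) {n : ℕ} {ι : Type} [Fintype ι] [DecidableEq ι]
    (enc : ι → Fin n → X) : 0 ≤ avgError W enc :=
  Real.iInf_nonneg fun _ =>
    div_nonneg (Finset.sum_nonneg fun _ _ => errorGiven_nonneg hW _ _ _) (Nat.cast_nonneg _)

lemma optMaxError_nonneg (hW : ∀ x y, 0 ≤ W x y) (M n : ℕ) : 0 ≤ optMaxError W M n :=
  Real.iInf_nonneg fun _ => maxError_nonneg hW _

lemma optAvgError_nonneg (hW : ∀ x y, 0 ≤ W x y) (M n : ℕ) : 0 ≤ optAvgError W M n :=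
  Real.iInf_nonneg fun _ => avgError_nonneg hW _

lemma errorGiven_le_one (hW : ∀ x y, 0 ≤ W x y) (hW1 : ∀ x, ∑ y, W x y = 1) {n : ℕ} {ι : Type}
    [DecidableEq ι] (enc : ι → Fin n → X) (dec : (Fin n → Y) → ι) (m : ι) :
    errorGiven W enc dec m ≤ 1 := by
  classical
  calc errorGiven W enc dec m ≤ ∑ y, memoryless W n (enc m) y :=
        Finset.sum_le_sum fun y _ => by
          split_ifs
          · exact memoryless_nonneg hW _ _
          · exact le_rfl
    _ = ∏ i, ∑ y, W (enc m i) y := by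
        rw [Finset.prod_univ_sum, Fintype.piFinset_univ]
        rfl
    _ = 1 := by simp [hW1]

lemma le_expo {n : ℕ} {p B : ℝ} (hp : 0 ≤ p) (hpB : p ≤ B) :
    ((1 / (n : ℝ) * Real.logb 2 (1 / B) : ℝ) : EReal) ≤ expo n p := by
  unfold expo
  split_ifs with h
  · exact le_top
  · have hp' : 0 < p := lt_of_le_of_ne hp (Ne.symm h)
    rw [EReal.coe_le_coe_iff]
    refine mul_le_mul_of_nonneg_left ?_ (by positivity)
    exact Real.logb_le_logb_of_le (by norm_num) (one_div_pos.2 (hp'.trans_le hpB))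
      (one_div_le_one_div_of_le hp' hpB)

variable [Fintype X]

lemma optMaxError_le {M n : ℕ} (hM : 0 < M) {enc : Fin M → Fin n → X} {B : ℝ}
    {dec : (Fin n → Y) → Fin M} (h : ∀ m, errorGiven W enc dec m ≤ B) : optMaxError W M n ≤ B :=
  haveI : Nonempty (Fin M) := ⟨⟨0, hM⟩⟩
  (ciInf_le (Set.finite_range _).bddBelow enc).trans (maxError_le h)

lemma optAvgError_le {M n : ℕ} (hM : 0 < M) {enc : Fin M → Fin n → X} {B : ℝ}
    {dec : (Fin n → Y) → Fin M} (h : ∀ m, errorGiven W enc dec m ≤ B) : optAvgError W M n ≤ B :=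
  haveI : Nonempty (Fin M) := ⟨⟨0, hM⟩⟩
  (ciInf_le (Set.finite_range _).bddBelow enc).trans (avgError_le h)

end UnionBound

/-! ### The typewriter channel -/

section Kernel

variable {q : ℕ}

lemma typewriter_nonneg {ε : ℝ} (h0 : 0 < ε) (h1 : ε ≤ 1 / 2) (x y : ZMod q) :
    0 ≤ typewriter q ε x y := by
  unfold typewriter
  split_ifs <;> linarith

/-- The kernel with value `1` on the diagonal, `β` on adjacent letters and `0` elsewhere. -/
def kernel (β : ℝ) (x y : ZMod q) : ℝ :=
  (if y = x then 1 else 0) + (if y = x + 1 then β else 0) + (if y = x - 1 then β else 0)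

lemma kernel_nonneg {β : ℝ} (hβ : 0 ≤ β) (x y : ZMod q) : 0 ≤ kernel β x y := by
  unfold kernel
  split_ifs <;> linarith

lemma natCast_ne_zero_of_lt (c : ℕ) (h0 : 0 < c) (hc : c < q) : (c : ZMod q) ≠ 0 := by
  rw [Ne, ZMod.natCast_eq_zero_iff]
  exact fun h => absurd (Nat.le_of_dvd h0 h) (by omega)

variable [NeZero q]

lemma sum_typewriter (hq : 4 ≤ q) (ε : ℝ) (x : ZMod q) : ∑ y, typewriter q ε x y = 1 := by
  have h1 : (1 : ZMod q) ≠ 0 := by simpa using natCast_ne_zero_of_lt (q := q) 1 (by omega) (by omega)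
  have : ∀ y, typewriter q ε x y = (if y = x then 1 - ε else 0) + (if y = x + 1 then ε else 0) := by
    intro y
    unfold typewriter
    by_cases h : y = x
    · subst h
      simp [h1]
    · simp [h]
  simp [this, Finset.sum_add_distrib]

/-- A letter reaches only itself and its successor. Since `1` and `2` are nonzero mod `q`,
neighbouring letters share exactly one output, with likelihoods `ε` and `1 - ε`. -/
lemma sum_sqrt_typewriter (hq : 4 ≤ q) {ε : ℝ} (h0 : 0 < ε) (h1 : ε ≤ 1 / 2) (x x' : ZMod q) :
    ∑ y, Real.sqrt (typewriter q ε x y * typewriter q ε x' y) = kernel (alpha ε) x x' := by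
  have e1 : (1 : ZMod q) ≠ 0 := by simpa using natCast_ne_zero_of_lt (q := q) 1 (by omega) (by omega)
  have e2 : (1 + 1 : ZMod q) ≠ 0 := by
    have := natCast_ne_zero_of_lt (q := q) 2 (by omega) (by omega)
    rwa [show ((2 : ℕ) : ZMod q) = 1 + 1 by norm_num] at this
  have hne : x ≠ x + 1 := by simp [e1]
  have hs : ∑ y, Real.sqrt (typewriter q ε x y * typewriter q ε x' y) =
      ∑ y ∈ {x, x + 1}, Real.sqrt (typewriter q ε x y * typewriter q ε x' y) := by
    symm
    refine Finset.sum_subset (Finset.subset_univ _) fun y _ hy => ?_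
    simp only [Finset.mem_insert, Finset.mem_singleton, not_or] at hy
    simp [typewriter, hy.1, hy.2]
  rw [hs, Finset.sum_pair hne]
  have hx0 : typewriter q ε x x = 1 - ε := by simp [typewriter]
  have hx1 : typewriter q ε x (x + 1) = ε := by simp [typewriter, e1]
  rw [hx0, hx1]
  by_cases ha : x' = x
  · subst ha
    have : x' ≠ x' - 1 := by
      intro h
      exact e1 (by simpa [sub_eq_self] using h.symm)
    rw [hx0, hx1, kernel, if_pos rfl, if_neg hne, if_neg this,
      Real.sqrt_mul_self (by linarith), Real.sqrt_mul_self h0.le]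
    ring
  by_cases hb : x' = x + 1
  · subst hb
    have e3 : x + 1 ≠ x - 1 := by
      intro h
      apply e2
      linear_combination h
    have e4 : typewriter q ε (x + 1) x = 0 := by
      have : x ≠ x + 1 + 1 := by
        intro h
        apply e2
        linear_combination -h
      simp [typewriter, e1, this]
    have e5 : typewriter q ε (x + 1) (x + 1) = 1 - ε := by simp [typewriter]
    rw [e4, e5, kernel, if_neg ha, if_pos rfl, if_neg e3, mul_zero, Real.sqrt_zero, alpha]
    ring
  by_cases hc : x' = x - 1
  · subst hc
    have e4 : typewriter q ε (x - 1) x = ε := by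
      have : x ≠ x - 1 := Ne.symm ha
      simp [typewriter, this]
    have e5 : typewriter q ε (x - 1) (x + 1) = 0 := by
      have : x + 1 ≠ x - 1 := Ne.symm hb
      simp [typewriter, this, e1]
    rw [e4, e5, kernel, if_neg ha, if_neg hb, if_pos rfl, mul_zero, Real.sqrt_zero, alpha,
      mul_comm (1 - ε)]
    ring
  · have e4 : typewriter q ε x' x = 0 := by
      have : x ≠ x' + 1 := by
        intro h
        apply hc
        linear_combination -h
      simp [typewriter, this, Ne.symm ha]
    have e5 : typewriter q ε x' (x + 1) = 0 := by
      have : x ≠ x' := Ne.symm ha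
      simp [typewriter, this, Ne.symm hb]
    rw [e4, e5, kernel, if_neg ha, if_neg hb, if_neg hc]
    simp

lemma bhatt_typewriter (hq : 4 ≤ q) {ε : ℝ} (h0 : 0 < ε) (h1 : ε ≤ 1 / 2) (k : ℕ)
    (x x' : Fin k → ZMod q) :
    bhatt (typewriter q ε) k x x' = ∏ i, kernel (alpha ε) (x i) (x' i) := by
  rw [bhatt_eq_prod (typewriter_nonneg h0 h1)]
  simp only [sum_sqrt_typewriter hq h0 h1]

end Kernel

/-! ### Unions of cosets of the zero-error code -/

section Coset

variable {q : ℕ}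

/-- Reduction modulo two. -/
def parity (h : 2 ∣ q) : ZMod q →+* ZMod 2 := ZMod.castHom h (ZMod 2)

/-- This is the zero-error property: a step of `±1` changes the parity. -/
lemma eq_of_kernel_ne_zero (h : 2 ∣ q) {β : ℝ} {x y : ZMod q} (hk : kernel β x y ≠ 0)
    (hp : parity h y = parity h x) : y = x := by
  by_contra hne
  have h1 : y ≠ x + 1 := by
    rintro rfl
    rw [map_add, map_one, add_eq_left] at hp
    exact absurd hp (by decide)
  have h2 : y ≠ x - 1 := by
    rintro rfl
    rw [map_sub, map_one, sub_eq_self] at hp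
    exact absurd hp (by decide)
  exact hk (by simp [kernel, hne, h1, h2])

variable [NeZero q]

/-- Splitting a letter into its even part and its parity bit identifies the coset code with a
preimage; later arguments use only this description. -/
lemma mem_cosetCode (h : 2 ∣ q) {n : ℕ} (C₂ : Submodule (ZMod 2) (Fin n → ZMod 2))
    (x : Fin n → ZMod q) : x ∈ cosetCode q C₂ ↔ (fun i => parity h (x i)) ∈ C₂ := by
  simp only [cosetCode, Finset.mem_filter, Finset.mem_univ, true_and]
  constructor
  · rintro ⟨a, ha, b, hb, rfl⟩
    convert hb using 1
    ext i
    obtain ⟨j, -, hj⟩ := ha i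
    rw [Pi.add_apply, hj, liftWord, map_add, map_natCast, map_natCast, Nat.cast_mul,
      ZMod.natCast_self, zero_mul, zero_add, ZMod.natCast_zmod_val]
  · intro hx
    refine ⟨x - liftWord q (fun i => parity h (x i)), fun i => ⟨(x i).val / 2, ?_, ?_⟩, _, hx, by simp⟩
    · have := ZMod.val_lt (x i)
      omega
    · have h1 : (parity h (x i)).val = (x i).val % 2 := by
        conv_lhs => rw [← ZMod.natCast_zmod_val (x i)]
        rw [map_natCast, ZMod.val_natCast]
      have h2 := Nat.div_add_mod (x i).val 2
      rw [Pi.sub_apply, liftWord, h1, sub_eq_iff_eq_add, ← Nat.cast_add, h2, ZMod.natCast_zmod_val]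

lemma card_parity_fiber (h : 2 ∣ q) (c : ZMod 2) :
    (Finset.univ.filter fun y : ZMod q => parity h y = c).card = q / 2 := by
  -- Translation by `1` exchanges the two fibres.
  have hs : ∀ c : ZMod 2, (Finset.univ.filter fun y : ZMod q => parity h y = c).card =
      (Finset.univ.filter fun y : ZMod q => parity h y = c + 1).card := by
    intro c
    refine Finset.card_bij (fun y _ => y + 1) ?_ ?_ ?_
    · intro y hy
      simp only [Finset.mem_filter, Finset.mem_univ, true_and] at hy ⊢
      rw [map_add, map_one, hy]
    · intro a _ b _ hab
      exact add_right_cancel hab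
    · intro y hy
      simp only [Finset.mem_filter, Finset.mem_univ, true_and] at hy
      exact ⟨y - 1, by simp [hy], by simp⟩
  have ht := Finset.card_eq_sum_card_fiberwise (s := (Finset.univ : Finset (ZMod q)))
    (t := Finset.univ) (f := parity h) (fun _ _ => Finset.mem_coe.2 (Finset.mem_univ _))
  rw [show (Finset.univ : Finset (ZMod 2)) = {0, 1} from rfl, Finset.sum_pair (by decide),
    Finset.card_univ, ZMod.card] at ht
  have h01 := hs 0
  rw [zero_add] at h01
  have hc : c = 0 ∨ c = 1 := by
    revert c
    decide
  rcases hc with rfl | rfl <;> omega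

lemma card_cosetCode (h : 2 ∣ q) {n : ℕ} (C₂ : Submodule (ZMod 2) (Fin n → ZMod 2)) :
    (cosetCode q C₂).card = 2 ^ Module.finrank (ZMod 2) C₂ * (q / 2) ^ n := by
  classical
  have ht := Finset.card_eq_sum_card_fiberwise (s := cosetCode q C₂)
    (t := Finset.univ.filter (· ∈ C₂)) (f := fun x i => parity h (x i))
    (fun x hx => by simpa using (mem_cosetCode h C₂ x).1 hx)
  rw [ht]
  have hf : ∀ b ∈ Finset.univ.filter (· ∈ C₂),
      ((cosetCode q C₂).filter fun x => (fun i => parity h (x i)) = b).card = (q / 2) ^ n := by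
    intro b hb
    have : (cosetCode q C₂).filter (fun x => (fun i => parity h (x i)) = b) =
        Fintype.piFinset fun i => Finset.univ.filter fun y : ZMod q => parity h y = b i := by
      ext x
      simp only [Finset.mem_filter, Fintype.mem_piFinset, Finset.mem_univ, true_and]
      constructor
      · rintro ⟨-, hx⟩ i
        exact congrFun hx i
      · intro hx
        have := funext hx
        refine ⟨(mem_cosetCode h C₂ x).2 ?_, this⟩
        rw [this]
        exact (Finset.mem_filter.1 hb).2
    rw [this, Fintype.card_piFinset]
    simp [card_parity_fiber]
  rw [Finset.sum_congr rfl hf, Finset.sum_const, smul_eq_mul, ← Fintype.card_subtype,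
    Module.card_eq_pow_finrank (K := ZMod 2) (V := C₂), ZMod.card]

/-- The source of the parameter `2α`: equal parity leaves only `x` itself, opposite parity leaves
its two neighbours. -/
lemma sum_kernel_parity (h : 2 ∣ q) (β : ℝ) (x : ZMod q) (b : ZMod 2) :
    ∑ y ∈ Finset.univ.filter (fun y => parity h y = parity h x + b), kernel β x y =
      if b = 0 then 1 else 2 * β := by
  have hb : b = 0 ∨ b = 1 := by
    revert b
    decide
  have h2 : (-1 : ZMod 2) = 1 := by decide
  rw [Finset.sum_filter]
  have hsplit : ∀ y, (if parity h y = parity h x + b then kernel β x y else 0) =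
      (if y = x then (if b = 0 then 1 else 0) else 0) +
      (if y = x + 1 then (if b = 1 then β else 0) else 0) +
      (if y = x - 1 then (if b = 1 then β else 0) else 0) := by
    intro y
    have e0 : y = x → (parity h y = parity h x + b ↔ b = 0) := by
      rintro rfl
      simp
    have e1 : y = x + 1 → (parity h y = parity h x + b ↔ b = 1) := by
      rintro rfl
      rw [map_add, map_one, add_right_inj, eq_comm]
    have e2 : y = x - 1 → (parity h y = parity h x + b ↔ b = 1) := by
      rintro rfl
      rw [map_sub, map_one, sub_eq_add_neg, h2, add_right_inj, eq_comm]
    unfold kernel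
    by_cases hp : parity h y = parity h x + b
    · simp only [hp, true_iff] at e0 e1 e2
      rw [if_pos hp]
      congr 1
      · congr 1
        · split_ifs with h1 h2
          · rfl
          · exact absurd (e0 h1) h2
          · rfl
        · split_ifs with h1 h2
          · rfl
          · exact absurd (e1 h1) h2
          · rfl
      · split_ifs with h1 h2
        · rfl
        · exact absurd (e2 h1) h2
        · rfl
    · simp only [hp, false_iff] at e0 e1 e2
      rw [if_neg hp]
      split_ifs <;> simp_all
  simp only [hsplit, Finset.sum_add_distrib, Finset.sum_ite_eq', Finset.mem_univ, if_true]
  rcases hb with rfl | rfl <;> simp [two_mul]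

/-- The union bound for a coset code is that of the binary code. -/
lemma sum_kernel_cosetCode_le (h : 2 ∣ q) {n : ℕ} (C₂ : Submodule (ZMod 2) (Fin n → ZMod 2))
    {β : ℝ} (hβ : 0 ≤ β) {x : Fin n → ZMod q} (hx : x ∈ cosetCode q C₂) :
    ∑ x' ∈ (cosetCode q C₂).erase x, ∏ i, kernel β (x i) (x' i) ≤
      codeMass (fun b => (2 * β) ^ hammingNorm b) C₂ := by
  classical
  have hnn : ∀ x' : Fin n → ZMod q, 0 ≤ ∏ i, kernel β (x i) (x' i) :=
    fun x' => Finset.prod_nonneg fun i _ => kernel_nonneg hβ _ _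
  rw [mem_cosetCode h] at hx
  -- Codewords are grouped by parity difference from `x`. Dropping vanishing terms removes the rest
  -- of the coset of `x`, so the difference is a nonzero word of `C₂`.
  rw [← Finset.sum_filter_ne_zero, ← Finset.sum_fiberwise_of_maps_to
    (g := fun x' i => parity h (x' i) - parity h (x i))
    (t := Finset.univ.filter fun b => b ∈ C₂ ∧ b ≠ 0), codeMass_eq_sum_filter]
  · refine Finset.sum_le_sum fun b _ => ?_
    have e : (2 * β) ^ hammingNorm b = ∏ i, if b i = 0 then 1 else 2 * β := by
      rw [prod_eq_zero_ite, one_pow, one_mul]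
    rw [e, ← Finset.prod_congr rfl fun i _ => sum_kernel_parity h β (x i) (b i),
      Finset.prod_univ_sum]
    refine Finset.sum_le_sum_of_subset_of_nonneg ?_ fun _ _ _ => hnn _
    intro x' hx'
    have := (Finset.mem_filter.1 hx').2
    simp only [Fintype.mem_piFinset, Finset.mem_filter, Finset.mem_univ, true_and]
    intro i
    rw [← congrFun this i]
    ring
  · intro x' hx'
    simp only [Finset.mem_filter, Finset.mem_erase, Finset.mem_univ, true_and] at hx' ⊢
    obtain ⟨⟨hne, hmem⟩, hk⟩ := hx'
    refine ⟨C₂.sub_mem ((mem_cosetCode h C₂ x').1 hmem) hx, fun h0 => hne ?_⟩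
    ext1 i
    exact eq_of_kernel_ne_zero h (Finset.prod_ne_zero_iff.1 hk i (Finset.mem_univ i))
      (sub_eq_zero.1 (congrFun h0 i))

end Coset

/-! ### Evaluation of the union bound on the Gilbert–Varshamov spectrum. -/

lemma codeMass_le_of_spectrum {ε r : ℝ} (h0 : 0 < ε) (h1 : ε ≤ 1 / 2) (hr0 : 0 ≤ r) (hr1 : r ≤ 1)
    {n : ℕ} (C : Submodule (ZMod 2) (Fin n → ZMod 2))
    (hC : ∀ z : ℕ, 1 ≤ z → z ≤ n →
        ((z : ℝ) < deltaGV r * n → weightCount C z = 0) ∧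
        (weightCount C z : ℝ) ≤ (2 : ℝ) ^ ((n : ℝ) * (r - 1 + h2 ((z : ℝ) / n)))) :
    codeMass (fun b => (2 * alpha ε) ^ hammingNorm b) C ≤
      4 * (n + 1) * 2 ^ (-(n * expurgatedBSC ε r)) := by
  classical
  have ha := alpha_pos h0 h1
  rw [codeMass_eq_sum_filter,
    ← Finset.sum_fiberwise_of_maps_to (g := fun b : Fin n → ZMod 2 => hammingNorm b)
      (t := Finset.range (n + 1))
      (fun b _ => by
        have := hammingNorm_le_card_fintype (x := b)
        rw [Fintype.card_fin] at this
        exact Finset.mem_range.2 (by omega))]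
  calc _ ≤ ∑ z ∈ Finset.range (n + 1), (2 : ℝ) ^ (-(n * expurgatedBSC ε r)) := by
        refine Finset.sum_le_sum fun z hz => ?_
        rw [Finset.mem_range] at hz
        rw [Finset.sum_congr rfl (g := fun _ => (2 * alpha ε) ^ z)
            (fun b hb => by rw [(Finset.mem_filter.1 hb).2]),
            Finset.sum_const, nsmul_eq_mul, Finset.filter_filter]
        rcases Nat.eq_zero_or_pos z with rfl | hz1
        · rw [Finset.filter_false_of_mem]
          · simp
            positivity
          · intro b _ hb
            exact hb.1.2 (hammingNorm_eq_zero.1 hb.2)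
        · have hw : ((Finset.univ.filter fun b : Fin n → ZMod 2 =>
              (b ∈ C ∧ b ≠ 0) ∧ hammingNorm b = z).card : ℝ) ≤ weightCount C z := by
            rw [weightCount, ← Set.ncard_coe_finset]
            refine Nat.cast_le.2 (Set.ncard_le_ncard ?_ (Set.toFinite _))
            intro b hb
            simp only [Finset.coe_filter, Finset.mem_univ, true_and] at hb
            exact ⟨hb.1.1, hb.2⟩
          refine (mul_le_mul_of_nonneg_right hw (by positivity)).trans ?_
          have hn : (0 : ℝ) < n := by exact_mod_cast (by omega : 0 < n)
          obtain ⟨c1, c2⟩ := hC z hz1 (by omega)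
          by_cases hlt : (z : ℝ) < deltaGV r * n
          · rw [c1 hlt, Nat.cast_zero, zero_mul]
            positivity
          · have ht : deltaGV r ≤ (z : ℝ) / n := by rw [le_div_iff₀ hn]; exact not_lt.1 hlt
            have ht1 : (z : ℝ) / n ≤ 1 := (div_le_one hn).2 (by exact_mod_cast (by omega : z ≤ n))
            have key := spectrum_exponent_le h0 h1 hr0 hr1 ht ht1
            have e : (2 * alpha ε) ^ z = (2 : ℝ) ^ ((n : ℝ) * (z / n * Real.logb 2 (2 * alpha ε))) := by
              rw [← mul_assoc, mul_div_cancel₀ _ hn.ne', mul_comm (z : ℝ), Real.rpow_mul (by norm_num),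
                Real.rpow_logb (by norm_num) (by norm_num) (by positivity), Real.rpow_natCast]
            calc _ ≤ (2 : ℝ) ^ ((n : ℝ) * (r - 1 + h2 ((z : ℝ) / n))) * (2 * alpha ε) ^ z := by gcongr
              _ = (2 : ℝ) ^ ((n : ℝ) * (r - 1 + h2 ((z : ℝ) / n) +
                    z / n * Real.logb 2 (2 * alpha ε))) := by
                  rw [e, ← Real.rpow_add (by norm_num), ← mul_add]
              _ ≤ _ := by
                  refine Real.rpow_le_rpow_of_exponent_le (by norm_num) ?_
                  rw [← mul_neg]
                  exact mul_le_mul_of_nonneg_left key hn.le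
    _ = (n + 1) * (2 : ℝ) ^ (-(n * expurgatedBSC ε r)) := by simp
    -- The factor `4` is slack, chosen so that `tendsto_logb_div` also serves for the error
    -- exponent.
    _ ≤ _ := by
        refine mul_le_mul_of_nonneg_right ?_ (by positivity)
        linarith [(Nat.cast_nonneg n : (0 : ℝ) ≤ n)]

/-! ### Achievability -/

lemma coe_le_of_forall_real_lt {E : ℝ} {L : EReal} (h : ∀ c : ℝ, c < E → (c : EReal) ≤ L) :
    (E : EReal) ≤ L := by
  refine le_of_forall_lt_imp_le_of_dense fun a ha => ?_
  obtain ⟨c, hac, hcE⟩ := EReal.lt_iff_exists_real_btwn.1 ha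
  exact hac.le.trans (h c (EReal.coe_lt_coe_iff.1 hcE))

lemma eventually_le_expo {c E : ℝ} (hc : c < E) :
    ∀ᶠ n : ℕ in atTop, ∀ p : ℝ, 0 ≤ p → p ≤ 4 * (n + 1) * 2 ^ (-(n * E)) →
      (c : EReal) ≤ expo n p := by
  have ht := tendsto_logb_div.eventually (gt_mem_nhds (sub_pos.2 hc))
  filter_upwards [ht, eventually_gt_atTop 0] with n hn hn0 p hp hpB
  refine le_trans ?_ (le_expo hp hpB)
  have hn' : (0 : ℝ) < n := by exact_mod_cast hn0
  rw [EReal.coe_le_coe_iff, one_div (4 * _ * _), Real.logb_inv,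
    Real.logb_mul (by positivity) (by positivity), Real.logb_rpow (by norm_num) (by norm_num)]
  have : 1 / (n : ℝ) * -(Real.logb 2 (4 * (n + 1)) + -(n * E)) =
      E - Real.logb 2 (4 * (n + 1)) / n := by field_simp; ring
  rw [this]
  linarith

section Typewriter

variable {q : ℕ} [NeZero q]

/-- Any injective family of codewords is allowed, so the bound covers both the full coset code and
subcodes of prescribed size. -/
lemma exists_decoder_cosetCode (hq : 4 ≤ q) (h2 : 2 ∣ q) {ε : ℝ} (h0 : 0 < ε) (h1 : ε ≤ 1 / 2)
    {n : ℕ} (C₂ : Submodule (ZMod 2) (Fin n → ZMod 2)) {ι : Type} [Fintype ι] [DecidableEq ι]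
    [Nonempty ι] {enc : ι → Fin n → ZMod q} (hinj : Function.Injective enc)
    (hmem : ∀ m, enc m ∈ cosetCode q C₂) :
    ∃ dec : (Fin n → ZMod q) → ι, ∀ m, errorGiven (typewriter q ε) enc dec m ≤
      codeMass (fun b => (2 * alpha ε) ^ hammingNorm b) C₂ := by
  obtain ⟨dec, hdec⟩ := exists_decoder_le (typewriter_nonneg (q := q) h0 h1) enc
  refine ⟨dec, fun m => (hdec m).trans
    (le_trans ?_ (sum_kernel_cosetCode_le h2 C₂ (alpha_pos h0 h1).le (hmem m)))⟩
  simp only [bhatt_typewriter hq h0 h1]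
  rw [← Finset.sum_image (f := fun x' => ∏ i, kernel (alpha ε) (enc m i) (x' i))
    (fun a _ b _ hab => hinj hab)]
  refine Finset.sum_le_sum_of_subset_of_nonneg ?_ fun x' _ _ =>
    Finset.prod_nonneg fun i _ => kernel_nonneg (alpha_pos h0 h1).le _ _
  intro x' hx'
  obtain ⟨m', hm', rfl⟩ := Finset.mem_image.1 hx'
  exact Finset.mem_erase.2 ⟨fun h => (Finset.mem_erase.1 hm').1 (hinj h), hmem m'⟩

lemma logb_card_cosetCode (h2 : 2 ∣ q) {n : ℕ} (hn : 0 < n)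
    (C₂ : Submodule (ZMod 2) (Fin n → ZMod 2)) :
    Real.logb 2 (cosetCode q C₂).card / n =
      (Module.finrank (ZMod 2) C₂ : ℝ) / n + Real.logb 2 (q / 2) := by
  have hn' : (n : ℝ) ≠ 0 := by exact_mod_cast hn.ne'
  have hq : (q : ℝ) ≠ 0 := by exact_mod_cast NeZero.ne q
  rw [card_cosetCode h2, Nat.cast_mul, Nat.cast_pow, Nat.cast_pow, Nat.cast_div h2 (by norm_num),
    Real.logb_mul (by positivity) (by positivity), Real.logb_pow, Real.logb_pow]
  simp only [Nat.cast_ofNat]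
  rw [Real.logb_self_eq_one (by norm_num)]
  field_simp

lemma exists_coset_codes (h2 : 2 ∣ q) {ε : ℝ} (h0 : 0 < ε) (h1 : ε ≤ 1 / 2)
    {r : ℝ} (hr0 : 0 ≤ r) (hr1 : r ≤ 1) :
    ∃ C₂ : ∀ n : ℕ, Submodule (ZMod 2) (Fin n → ZMod 2),
      HasGVSpectrum r C₂ ∧
      Tendsto (fun n : ℕ => (Module.finrank (ZMod 2) (C₂ n) : ℝ) / n) atTop (𝓝 r) ∧
      Tendsto (fun n : ℕ => Real.logb 2 (cosetCode q (C₂ n)).card / n) atTop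
        (𝓝 (r + Real.logb 2 (q / 2))) ∧
      ∀ n, codeMass (fun b => (2 * alpha ε) ^ hammingNorm b) (C₂ n) ≤
        4 * (n + 1) * 2 ^ (-(n * expurgatedBSC ε r)) := by
  choose C₂ hdim hspec using fun n => exists_gv_code hr0 hr1 n
  have hT : Tendsto (fun n : ℕ => (Module.finrank (ZMod 2) (C₂ n) : ℝ) / n) atTop (𝓝 r) := by
    simp only [hdim]
    exact tendsto_gvDim hr0
  -- No `o(1)` is needed: the polynomial loss was already taken out of the dimension.
  refine ⟨C₂, ⟨fun _ => 0, tendsto_const_nhds, ?_⟩, hT, ?_,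
    fun n => codeMass_le_of_spectrum h0 h1 hr0 hr1 (C₂ n) (hspec n)⟩
  · intro n z hz hzn
    simpa only [add_zero] using hspec n z hz hzn
  · refine (hT.add_const _).congr' ?_
    filter_upwards [eventually_gt_atTop 0] with n hn
    exact (logb_card_cosetCode h2 hn _).symm

lemma cosetCode_nonempty (h2 : 2 ∣ q) {n : ℕ} (C₂ : Submodule (ZMod 2) (Fin n → ZMod 2)) :
    (cosetCode q C₂).Nonempty :=
  ⟨0, (mem_cosetCode h2 C₂ 0).2 (by
    simp only [Pi.zero_apply, map_zero]
    exact C₂.zero_mem)⟩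

lemma le_liminf_maxError_cosetCode (hq : 4 ≤ q) (h2 : 2 ∣ q) {ε E : ℝ} (h0 : 0 < ε)
    (h1 : ε ≤ 1 / 2) {C₂ : ∀ n : ℕ, Submodule (ZMod 2) (Fin n → ZMod 2)}
    (hC : ∀ n, codeMass (fun b => (2 * alpha ε) ^ hammingNorm b) (C₂ n) ≤
        4 * (n + 1) * 2 ^ (-(n * E))) :
    (E : EReal) ≤ liminf (fun n : ℕ => expo n (maxError (typewriter q ε)
        (fun x : {x // x ∈ cosetCode q (C₂ n)} => x.1))) atTop := by
  refine coe_le_of_forall_real_lt fun c hc => le_liminf_of_le (by isBoundedDefault) ?_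
  filter_upwards [eventually_le_expo hc] with n hn
  have : Nonempty {x // x ∈ cosetCode q (C₂ n)} := (cosetCode_nonempty h2 _).to_subtype
  obtain ⟨dec, hdec⟩ := exists_decoder_cosetCode hq h2 h0 h1 (C₂ n)
    (enc := fun x : {x // x ∈ cosetCode q (C₂ n)} => x.1) Subtype.val_injective (fun m => m.2)
  exact hn _ (maxError_nonneg (typewriter_nonneg h0 h1) _)
    ((maxError_le hdec).trans (hC n))

/-- Codes built at rate `r` may fall short of `2 ^ (nR)` words, so for `r < 1` codes of a slightly
larger rate `r'` are cut down to the required size. -/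
lemma eventually_le_expo_optError (hq : 4 ≤ q) (h2 : 2 ∣ q) {ε r c : ℝ} (h0 : 0 < ε)
    (h1 : ε ≤ 1 / 2) (hr0 : 0 < r) (hc : c < expurgatedBSC ε r) :
    ∀ᶠ n : ℕ in atTop,
      (c : EReal) ≤ expo n (optAvgError (typewriter q ε)
        ⌈(2 : ℝ) ^ ((n : ℝ) * (r + Real.logb 2 (q / 2)))⌉₊ n) ∧
      (c : EReal) ≤ expo n (optMaxError (typewriter q ε)
        ⌈(2 : ℝ) ^ ((n : ℝ) * (r + Real.logb 2 (q / 2)))⌉₊ n) := by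
  have hW := typewriter_nonneg (q := q) h0 h1
  have hM : ∀ n : ℕ, 0 < ⌈(2 : ℝ) ^ ((n : ℝ) * (r + Real.logb 2 (q / 2)))⌉₊ :=
    fun n => Nat.ceil_pos.2 (by positivity)
  rcases le_or_gt 1 r with hr1 | hr1
  · refine Eventually.of_forall fun n => ?_
    have hc0 : c ≤ 1 / (n : ℝ) * Real.logb 2 (1 / 1) := by
      simpa using (hc.trans_le (expurgatedBSC_nonpos h0 h1 hr1)).le
    have herr : ∀ m, errorGiven (typewriter q ε)
        (fun (_ : Fin ⌈(2 : ℝ) ^ ((n : ℝ) * (r + Real.logb 2 (q / 2)))⌉₊) (_ : Fin n) => (0 : ZMod q))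
        (fun _ => ⟨0, hM n⟩) m ≤ 1 :=
      fun m => errorGiven_le_one hW (sum_typewriter hq ε) _ _ _
    exact ⟨(EReal.coe_le_coe_iff.2 hc0).trans
        (le_expo (optAvgError_nonneg hW _ _) (optAvgError_le (hM n) herr)),
      (EReal.coe_le_coe_iff.2 hc0).trans
        (le_expo (optMaxError_nonneg hW _ _) (optMaxError_le (hM n) herr))⟩
  · obtain ⟨r', hrr', hr1', hc'⟩ := exists_expurgatedBSC_gt h0 h1 hr0 hr1 hc
    obtain ⟨C₂, -, -, hcard, hmass⟩ :=
      exists_coset_codes (q := q) h2 h0 h1 (hr0.le.trans hrr'.le) hr1'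
    have hlt : r + Real.logb 2 (q / 2) < r' + Real.logb 2 (q / 2) := by linarith
    filter_upwards [eventually_le_expo hc', hcard.eventually (lt_mem_nhds hlt),
      eventually_gt_atTop 0] with n hn hcn hn0
    have hn' : (0 : ℝ) < n := by exact_mod_cast hn0
    have hcpos : (0 : ℝ) < (cosetCode q (C₂ n)).card := by
      exact_mod_cast (cosetCode_nonempty h2 (C₂ n)).card_pos
    have hle : ⌈(2 : ℝ) ^ ((n : ℝ) * (r + Real.logb 2 (q / 2)))⌉₊ ≤ (cosetCode q (C₂ n)).card := by
      rw [Nat.ceil_le, ← Real.le_logb_iff_rpow_le (by norm_num) hcpos, mul_comm]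
      exact ((lt_div_iff₀ hn').1 hcn).le
    have : Nonempty (Fin ⌈(2 : ℝ) ^ ((n : ℝ) * (r + Real.logb 2 (q / 2)))⌉₊) := ⟨⟨0, hM n⟩⟩
    obtain ⟨dec, hdec⟩ := exists_decoder_cosetCode hq h2 h0 h1 (C₂ n)
      (enc := fun m : Fin ⌈(2 : ℝ) ^ ((n : ℝ) * (r + Real.logb 2 (q / 2)))⌉₊ =>
        ((cosetCode q (C₂ n)).equivFin.symm (Fin.castLE hle m)).1)
      (fun a b hab => Fin.castLE_injective hle
        ((cosetCode q (C₂ n)).equivFin.symm.injective (Subtype.ext hab)))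
      (fun m => Subtype.property _)
    exact ⟨hn _ (optAvgError_nonneg hW _ _) ((optAvgError_le (hM n) hdec).trans (hmass n)),
      hn _ (optMaxError_nonneg hW _ _) ((optMaxError_le (hM n) hdec).trans (hmass n))⟩

lemma expurgatedBSC_le_reliability (hq : 4 ≤ q) (h2 : 2 ∣ q) {ε r : ℝ} (h0 : 0 < ε)
    (h1 : ε ≤ 1 / 2) (hr0 : 0 < r) :
    (expurgatedBSC ε r : EReal) ≤ reliabilityAvg (typewriter q ε) (r + Real.logb 2 (q / 2)) ∧
    (expurgatedBSC ε r : EReal) ≤ reliabilityMax (typewriter q ε) (r + Real.logb 2 (q / 2)) := by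
  constructor <;> refine coe_le_of_forall_real_lt fun c hc => ?_
  · exact (le_liminf_of_le (by isBoundedDefault) ((eventually_le_expo_optError hq h2 h0 h1 hr0
      hc).mono fun n hn => hn.1)).trans liminf_le_limsup
  · exact (le_liminf_of_le (by isBoundedDefault) ((eventually_le_expo_optError hq h2 h0 h1 hr0
      hc).mono fun n hn => hn.2)).trans liminf_le_limsup

end Typewriter

/-! ### The multiletter expurgated exponent -/

section Expurgated

variable {q : ℕ}

/-- Gram vectors of `kernel β`. -/
def gram (β : ℝ) : ZMod q ⊕ ZMod q → ZMod q → ℝ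
  | .inl t, x => if t = x then Real.sqrt (1 - 2 * β) else 0
  | .inr t, x => (if t = x then Real.sqrt β else 0) + (if t = x + 1 then Real.sqrt β else 0)

lemma kernel_eq_ite (hq : 4 ≤ q) (β : ℝ) (x y : ZMod q) :
    kernel β x y = if y = x then 1 else if y = x + 1 ∨ y = x - 1 then β else 0 := by
  have e1 : (1 : ZMod q) ≠ 0 := by simpa using natCast_ne_zero_of_lt (q := q) 1 (by omega) (by omega)
  have e2 : (1 + 1 : ZMod q) ≠ 0 := by
    have := natCast_ne_zero_of_lt (q := q) 2 (by omega) (by omega)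
    rwa [show ((2 : ℕ) : ZMod q) = 1 + 1 by norm_num] at this
  unfold kernel
  by_cases ha : y = x
  · subst ha
    have : y ≠ y - 1 := fun h => e1 (by linear_combination h)
    simp [e1, this]
  by_cases hb : y = x + 1
  · subst hb
    have : x + 1 ≠ x - 1 := fun h => e2 (by linear_combination h)
    simp [e1, this]
  · simp [ha, hb]

/-- Allows `β` to be capped at `1/2`, where the kernel is still positive semidefinite, when `a ^ s`
is larger. -/
lemma kernel_le_rpow (hq : 4 ≤ q) {a β s : ℝ} (hs : 0 < s) (hβ : β ≤ a ^ s) (x y : ZMod q) :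
    kernel β x y ≤ kernel a x y ^ s := by
  rw [kernel_eq_ite hq, kernel_eq_ite hq]
  split_ifs
  · simp
  · exact hβ
  · rw [Real.zero_rpow hs.ne']

variable [NeZero q]

/-- With `S` the cyclic shift, the kernel is `(1 - 2β) I + β (I + S)ᵀ (I + S)`; this needs `β ≤
1/2`. -/
lemma kernel_eq_gram {β : ℝ} (h0 : 0 ≤ β) (h1 : β ≤ 1 / 2) (x y : ZMod q) :
    kernel β x y = ∑ t, gram β t x * gram β t y := by
  have e1 := Real.mul_self_sqrt h0
  have e2 := Real.mul_self_sqrt (by linarith : 0 ≤ 1 - 2 * β)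
  rw [Fintype.sum_sum_type]
  simp only [gram, add_mul, ite_mul, zero_mul, Finset.sum_add_distrib, Finset.sum_ite_eq',
    Finset.mem_univ, if_true, mul_add, mul_ite, mul_zero, e1, e2]
  have c : (y + 1 = x) = (y = x - 1) := propext eq_sub_iff_add_eq.symm
  simp only [add_left_inj, c, kernel]
  split_ifs <;> ring

lemma kernel_comm {β : ℝ} (h0 : 0 ≤ β) (h1 : β ≤ 1 / 2) (x y : ZMod q) :
    kernel β x y = kernel β y x := by
  rw [kernel_eq_gram h0 h1, kernel_eq_gram h0 h1]
  exact Finset.sum_congr rfl fun t _ => mul_comm _ _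

lemma sum_prod_kernel (β : ℝ) {k : ℕ} (x : Fin k → ZMod q) :
    ∑ y : Fin k → ZMod q, ∏ i, kernel β (x i) (y i) = (1 + 2 * β) ^ k := by
  have h : ∀ a : ZMod q, ∑ y, kernel β a y = 1 + 2 * β := by
    intro a
    simp only [kernel, Finset.sum_add_distrib, Finset.sum_ite_eq', Finset.mem_univ, if_true]
    ring
  have := Finset.prod_univ_sum (fun _ : Fin k => (Finset.univ : Finset (ZMod q)))
    (fun i a => kernel β (x i) a)
  rw [Fintype.piFinset_univ] at this
  rw [← this]
  simp [h]

/-- Products of Gram vectors are Gram vectors of the tensor power, so the form is a sum of squares.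
-/
lemma kernel_form_nonneg {β : ℝ} (h0 : 0 ≤ β) (h1 : β ≤ 1 / 2) {k : ℕ}
    (v : (Fin k → ZMod q) → ℝ) :
    0 ≤ ∑ x, ∑ y, v x * v y * ∏ i, kernel β (x i) (y i) := by
  have hprod : ∀ x y : Fin k → ZMod q, ∏ i, kernel β (x i) (y i) =
      ∑ τ : Fin k → ZMod q ⊕ ZMod q, (∏ i, gram β (τ i) (x i)) * ∏ i, gram β (τ i) (y i) := by
    intro x y
    simp only [kernel_eq_gram h0 h1, ← Finset.prod_mul_distrib]
    rw [Finset.prod_univ_sum, Fintype.piFinset_univ]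
  have : ∑ x, ∑ y, v x * v y * ∏ i, kernel β (x i) (y i) =
      ∑ τ : Fin k → ZMod q ⊕ ZMod q, (∑ x, v x * ∏ i, gram β (τ i) (x i)) ^ 2 := by
    simp only [sq, Finset.sum_mul_sum]
    symm
    rw [Finset.sum_comm]
    refine Finset.sum_congr rfl fun x _ => ?_
    rw [Finset.sum_comm]
    refine Finset.sum_congr rfl fun y _ => ?_
    rw [hprod, Finset.mul_sum]
    exact Finset.sum_congr rfl fun τ _ => by ring
  rw [this]
  exact Finset.sum_nonneg fun _ _ => sq_nonneg _

/-- The left side is the value at the uniform distribution. Row and column sums are constant, so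
evaluating the nonnegative form at `P` minus uniform gives exactly the difference of the two values.
-/
lemma le_kernel_form {β : ℝ} (h0 : 0 ≤ β) (h1 : β ≤ 1 / 2) {k : ℕ}
    (P : (Fin k → ZMod q) → ℝ) (hP : ∑ x, P x = 1) :
    ((1 + 2 * β) / q) ^ k ≤ ∑ x, ∑ y, P x * P y * ∏ i, kernel β (x i) (y i) := by
  have hq : (q : ℝ) ≠ 0 := by exact_mod_cast NeZero.ne q
  set u : ℝ := 1 / (q : ℝ) ^ k with hu
  have huq : (q : ℝ) ^ k * u = 1 := by rw [hu]; field_simp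
  have hcol : ∀ y : Fin k → ZMod q, ∑ x : Fin k → ZMod q, ∏ i, kernel β (x i) (y i) =
      (1 + 2 * β) ^ k := by
    intro y
    rw [← sum_prod_kernel β y]
    exact Finset.sum_congr rfl fun x _ => Finset.prod_congr rfl fun i _ => kernel_comm h0 h1 _ _
  have key := kernel_form_nonneg h0 h1 (fun x => P x - u)
  have e : ∑ x, ∑ y, (P x - u) * (P y - u) * ∏ i, kernel β (x i) (y i) =
      ∑ x, ∑ y, P x * P y * ∏ i, kernel β (x i) (y i) - u * (1 + 2 * β) ^ k := by
    have s1 : ∑ x, ∑ y : Fin k → ZMod q, P x * ∏ i, kernel β (x i) (y i) = (1 + 2 * β) ^ k := by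
      simp only [← Finset.mul_sum, sum_prod_kernel, ← Finset.sum_mul, hP, one_mul]
    have s2 : ∑ x : Fin k → ZMod q, ∑ y, P y * ∏ i, kernel β (x i) (y i) = (1 + 2 * β) ^ k := by
      rw [Finset.sum_comm]
      simp only [← Finset.mul_sum, hcol, ← Finset.sum_mul, hP, one_mul]
    have s3 : ∑ x : Fin k → ZMod q, ∑ y : Fin k → ZMod q, ∏ i, kernel β (x i) (y i) =
        (q : ℝ) ^ k * (1 + 2 * β) ^ k := by
      simp [sum_prod_kernel]
    have : ∀ x y : Fin k → ZMod q, (P x - u) * (P y - u) * ∏ i, kernel β (x i) (y i) =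
        P x * P y * ∏ i, kernel β (x i) (y i) - u * (P x * ∏ i, kernel β (x i) (y i)) -
        u * (P y * ∏ i, kernel β (x i) (y i)) + u * u * ∏ i, kernel β (x i) (y i) :=
      fun x y => by ring
    simp only [this, Finset.sum_add_distrib, Finset.sum_sub_distrib]
    simp only [← Finset.mul_sum] at s1 s2 s3 ⊢
    rw [s1, s2, s3]
    linear_combination u * (1 + 2 * β) ^ k * huq
  rw [e] at key
  rw [div_pow, div_eq_mul_one_div, ← hu, mul_comm]
  linarith

lemma le_quadForm (hq : 4 ≤ q) {ε β ρ : ℝ} (h0 : 0 < ε) (h1 : ε ≤ 1 / 2) (hρ : 0 < ρ)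
    (hβ0 : 0 ≤ β) (hβ : β ≤ 1 / 2) (hβα : β ≤ alpha ε ^ (1 / ρ)) {k : ℕ}
    {P : (Fin k → ZMod q) → ℝ} (hP : P ∈ stdSimplex ℝ (Fin k → ZMod q)) :
    ((1 + 2 * β) / q) ^ k ≤ quadForm (typewriter q ε) k ρ P := by
  refine (le_kernel_form hβ0 hβ P hP.2).trans ?_
  refine Finset.sum_le_sum fun x _ => Finset.sum_le_sum fun y _ => ?_
  refine mul_le_mul_of_nonneg_left ?_ (mul_nonneg (hP.1 x) (hP.1 y))
  rw [bhatt_typewriter hq h0 h1,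
    ← Real.finsetProd_rpow _ _ (fun i _ => kernel_nonneg (alpha_pos h0 h1).le _ _)]
  exact Finset.prod_le_prod (fun i _ => kernel_nonneg hβ0 _ _)
    fun i _ => kernel_le_rpow hq (one_div_pos.2 hρ) hβα _ _

/-- The `k`-th power in the bound on the form cancels the normalisation `1 / k`, so block length
brings no gain. -/
lemma expurgatedX_le (hq : 4 ≤ q) {ε β ρ : ℝ} (h0 : 0 < ε) (h1 : ε ≤ 1 / 2) (hρ : 0 < ρ)
    (hβ0 : 0 ≤ β) (hβ : β ≤ 1 / 2) (hβα : β ≤ alpha ε ^ (1 / ρ)) {k : ℕ} (hk : 1 ≤ k) :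
    expurgatedX (typewriter q ε) k ρ ≤ ρ * (Real.logb 2 q - Real.logb 2 (1 + 2 * β)) := by
  have hq' : (0 : ℝ) < q := by exact_mod_cast NeZero.pos q
  have hk' : (0 : ℝ) < k := by exact_mod_cast hk
  have hinf : ((1 + 2 * β) / q) ^ k ≤
      sInf (quadForm (typewriter q ε) k ρ '' stdSimplex ℝ (Fin k → ZMod q)) := by
    refine le_csInf (Set.Nonempty.image _ ⟨_, single_mem_stdSimplex ℝ (0 : Fin k → ZMod q)⟩) ?_
    rintro _ ⟨P, hP, rfl⟩
    exact le_quadForm hq h0 h1 hρ hβ0 hβ hβα hP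
  have hlog := Real.logb_le_logb_of_le (by norm_num : (1 : ℝ) < 2) (by positivity) hinf
  rw [Real.logb_pow, Real.logb_div (by positivity) hq'.ne'] at hlog
  have := mul_le_mul_of_nonneg_left hlog (by positivity : 0 ≤ ρ / k)
  have e : ρ / k * (k * (Real.logb 2 (1 + 2 * β) - Real.logb 2 q)) =
      ρ * (Real.logb 2 (1 + 2 * β) - Real.logb 2 q) := by field_simp
  rw [e] at this
  unfold expurgatedX
  linarith

end Expurgated

/-! ### A gap to the multiletter exponent that is uniform in `ρ`. -/

/-- Bound on the multiletter exponents at `ρ` and rate `r + log (q / 2)`. -/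
def expurgatedBound (ε r ρ : ℝ) : ℝ :=
  ρ * (1 - r - Real.logb 2 (1 + 2 * min (alpha ε ^ (1 / ρ)) (1 / 2)))

lemma expurgatedBound_lt {ε r ρ : ℝ} (h0 : 0 < ε) (h1 : ε < 1 / 2) (hr0 : 0 < r)
    (hr : r < rateExBSC ε) (hρ : 1 ≤ ρ) : expurgatedBound ε r ρ < expurgatedBSC ε r := by
  have ha := alpha_pos h0 h1.le
  have hb := alpha_lt_half h1
  have hr1 := hr.le.trans (rateExBSC_le_one h0 h1.le)
  obtain ⟨hd, hdr⟩ := deltaGV_spec hr0.le hr1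
  have hlt := exBSC_prob_lt_deltaGV h0 h1.le hr0.le hr
  have hd0 : 0 < deltaGV r := (exBSC_prob_mem h0 h1.le).1.trans_lt hlt
  have hd1 : deltaGV r ≤ 1 := by linarith [hd.2]
  have hρ0 : 0 < ρ := by linarith
  rw [expurgatedBSC, if_neg (not_le.2 hr), expurgatedBound]
  have hneg : Real.logb 2 (2 * alpha ε) < 0 :=
    Real.logb_neg (by norm_num) (by positivity) (by linarith)
  rcases le_total (alpha ε ^ (1 / ρ)) (1 / 2) with hm | hm
  · rw [min_eq_left hm]
    have hx : 0 < 2 * alpha ε ^ (1 / ρ) := by positivity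
    rcases hρ.eq_or_lt with rfl | hρ1
    · rw [div_one, Real.rpow_one]
      have := h2_add_mul_logb_lt hd.1 hd1 (by positivity : 0 < 2 * alpha ε) hlt.ne'
      linarith
    -- Gibbs at `δ = deltaGV r` bounds the left side by `-δ (ρ + log α)`, against the target `-δ (1
    -- + log α)`.
    · have hg := h2_add_mul_logb_le hd.1 hd1 hx
      have e1 : Real.logb 2 (2 * alpha ε) = 1 + Real.logb 2 (alpha ε) := by
        rw [Real.logb_mul (by norm_num) ha.ne', Real.logb_self_eq_one (by norm_num)]
      have e2 : Real.logb 2 (2 * alpha ε ^ (1 / ρ)) = 1 + 1 / ρ * Real.logb 2 (alpha ε) := by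
        rw [Real.logb_mul (by norm_num) (by positivity), Real.logb_self_eq_one (by norm_num),
          Real.logb_rpow_eq_mul_logb_of_pos ha]
      rw [e2] at hg
      rw [e1]
      calc _ ≤ ρ * (-(deltaGV r * (1 + 1 / ρ * Real.logb 2 (alpha ε)))) :=
            mul_le_mul_of_nonneg_left (by linarith) hρ0.le
        _ = -deltaGV r * (ρ + Real.logb 2 (alpha ε)) := by field_simp
        _ < _ := by nlinarith
  · rw [min_eq_right hm, show (1 : ℝ) + 2 * (1 / 2) = 2 by norm_num,
      Real.logb_self_eq_one (by norm_num)]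
    nlinarith [mul_pos hd0 (neg_pos.2 hneg), mul_pos hρ0 hr0]

/-- Pointwise strictness could be lost in the supremum over `ρ`; a maximum on a compact interval and
monotonicity beyond it prevent this. -/
lemma exists_expurgatedBound_le {ε r : ℝ} (h0 : 0 < ε) (h1 : ε < 1 / 2) (hr0 : 0 < r)
    (hr : r < rateExBSC ε) :
    ∃ B < expurgatedBSC ε r, ∀ ρ, 1 ≤ ρ → expurgatedBound ε r ρ ≤ B := by
  have ha := alpha_pos h0 h1.le
  -- From this threshold on `α^(1/ρ) ≥ 1/2`, so the cap is active and the bound is `-ρ r`.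
  set ρ₁ : ℝ := max 1 (-Real.logb 2 (alpha ε)) with hρ₁
  have hne : (Set.Icc 1 ρ₁).Nonempty := Set.nonempty_Icc.2 (le_max_left _ _)
  have hcont : ContinuousOn (expurgatedBound ε r) (Set.Icc 1 ρ₁) := by
    unfold expurgatedBound
    have hρ : ∀ ρ ∈ Set.Icc 1 ρ₁, ρ ≠ 0 := fun ρ hρ => by linarith [hρ.1]
    have hc : ContinuousOn (fun ρ : ℝ => alpha ε ^ (1 / ρ)) (Set.Icc 1 ρ₁) :=
      ContinuousOn.rpow continuousOn_const (continuousOn_const.div continuousOn_id hρ)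
        fun _ _ => Or.inl ha.ne'
    have hpos : ∀ ρ ∈ Set.Icc 1 ρ₁, 1 + 2 * min (alpha ε ^ (1 / ρ)) (1 / 2) ≠ 0 := by
      intro ρ _
      have : 0 ≤ min (alpha ε ^ (1 / ρ)) (1 / 2) := le_min (by positivity) (by norm_num)
      linarith
    unfold Real.logb
    exact continuousOn_id.mul (continuousOn_const.sub
      ((ContinuousOn.log (continuousOn_const.add (continuousOn_const.mul
        (hc.inf continuousOn_const))) hpos).div_const _))
  obtain ⟨ρ₀, hρ₀, hmax⟩ := isCompact_Icc.exists_isMaxOn hne hcont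
  refine ⟨max (expurgatedBound ε r ρ₀) (expurgatedBound ε r ρ₁), ?_, fun ρ hρ => ?_⟩
  · exact max_lt (expurgatedBound_lt h0 h1 hr0 hr hρ₀.1)
      (expurgatedBound_lt h0 h1 hr0 hr (le_max_left _ _))
  · rcases le_total ρ ρ₁ with h | h
    · exact (hmax ⟨hρ, h⟩).trans (le_max_left _ _)
    · have hlarge : ∀ ρ, ρ₁ ≤ ρ → expurgatedBound ε r ρ = -(ρ * r) := by
        intro ρ hle
        have hρ0 : 0 < ρ := by linarith [le_max_left 1 (-Real.logb 2 (alpha ε))]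
        have : 1 / 2 ≤ alpha ε ^ (1 / ρ) := by
          have hl : -1 ≤ 1 / ρ * Real.logb 2 (alpha ε) := by
            rw [one_div_mul_eq_div, le_div_iff₀ hρ0]
            linarith [le_max_right 1 (-Real.logb 2 (alpha ε))]
          rw [← Real.logb_rpow_eq_mul_logb_of_pos ha,
            Real.le_logb_iff_rpow_le (by norm_num) (by positivity), Real.rpow_neg_one] at hl
          linarith
        rw [expurgatedBound, min_eq_right this, show (1 : ℝ) + 2 * (1 / 2) = 2 by norm_num,
          Real.logb_self_eq_one (by norm_num)]
        ring
      refine le_trans ?_ (le_max_right _ _)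
      rw [hlarge ρ h, hlarge ρ₁ le_rfl]
      nlinarith

lemma expurgatedInf_lt {q : ℕ} [NeZero q] (hq : 4 ≤ q) {ε r : ℝ} (h0 : 0 < ε) (h1 : ε < 1 / 2)
    (hr0 : 0 < r) (hr : r < rateExBSC ε) :
    expurgatedInf (typewriter q ε) (r + Real.logb 2 (q / 2)) < (expurgatedBSC ε r : EReal) := by
  have ha := alpha_pos h0 h1.le
  have hq' : (q : ℝ) ≠ 0 := by exact_mod_cast NeZero.ne q
  obtain ⟨B, hB, hle⟩ := exists_expurgatedBound_le h0 h1 hr0 hr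
  refine lt_of_le_of_lt ?_ (EReal.coe_lt_coe_iff.2 hB)
  refine iSup_le fun k => iSup_le fun ρ => EReal.coe_le_coe_iff.2 (le_trans ?_ (hle ρ ρ.2))
  have hρ0 : 0 < (ρ : ℝ) := by linarith [ρ.2]
  have hX := expurgatedX_le hq h0 h1.le hρ0
    (le_min (by positivity) (by norm_num) : 0 ≤ min (alpha ε ^ (1 / (ρ : ℝ))) (1 / 2))
    (min_le_right _ _) (min_le_left _ _) k.2
  rw [Real.logb_div hq' (by norm_num), Real.logb_self_eq_one (by norm_num), expurgatedBound]
  linarith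

/-- Ensures that some rates with a strict gap lie below the critical rate. -/
lemma logb_lt_rateCrit {q : ℕ} [NeZero q] {ε : ℝ} (h0 : 0 < ε) (h1 : ε < 1 / 2) :
    Real.logb 2 (q / 2) < rateCrit q ε := by
  have hq' : (q : ℝ) ≠ 0 := by exact_mod_cast NeZero.ne q
  have hs := Real.sqrt_lt_sqrt h0.le (by linarith : ε < 1 - ε)
  have hs0 := Real.sqrt_pos.2 h0
  have : Real.sqrt ε / (Real.sqrt ε + Real.sqrt (1 - ε)) < 1 / 2 := by
    rw [div_lt_div_iff₀ (by positivity) (by norm_num)]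
    linarith
  have := h2_lt_one this
  rw [Real.logb_div hq' (by norm_num), Real.logb_self_eq_one (by norm_num), rateCrit]
  linarith

end Typewriter

end

/-! ### The main theorem. -/

theorem theorem2 (q : ℕ) [NeZero q] (hq : 4 ≤ q) (heven : Even q)
    (ε : ℝ) (hε0 : 0 < ε) (hε : ε ≤ 1 / 2) :
    -- the lower bound on the reliability function
    (∀ R : ℝ, Real.logb 2 (q / 2) < R →
      (Typewriter.expurgatedBSC ε (R - Real.logb 2 (q / 2)) : EReal) ≤
          Typewriter.reliabilityAvg (Typewriter.typewriter q ε) R ∧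
      (Typewriter.expurgatedBSC ε (R - Real.logb 2 (q / 2)) : EReal) ≤
          Typewriter.reliabilityMax (Typewriter.typewriter q ε) R) ∧
    -- it is attained by unions of cosets of the zero-error code
    (∀ R : ℝ, Real.logb 2 (q / 2) < R → R ≤ Real.logb 2 q →
      ∃ C₂ : ∀ n : ℕ, Submodule (ZMod 2) (Fin n → ZMod 2),
        Typewriter.HasGVSpectrum (R - Real.logb 2 (q / 2)) C₂ ∧
        Tendsto (fun n : ℕ => (Module.finrank (ZMod 2) (C₂ n) : ℝ) / n) atTop
          (𝓝 (R - Real.logb 2 (q / 2))) ∧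
        Tendsto (fun n : ℕ => Real.logb 2 (Typewriter.cosetCode q (C₂ n)).card / n) atTop (𝓝 R) ∧
        (Typewriter.expurgatedBSC ε (R - Real.logb 2 (q / 2)) : EReal) ≤
          liminf (fun n : ℕ => Typewriter.expo n
            (Typewriter.maxError (Typewriter.typewriter q ε)
              (fun x : {x // x ∈ Typewriter.cosetCode q (C₂ n)} => x.1))) atTop) ∧
    -- it beats the multiletter expurgated bound and refutes its tightness below the critical rate
    (ε < 1 / 2 →
      0 < Typewriter.rateExBSC ε ∧
      (∀ R : ℝ, Real.logb 2 (q / 2) < R → R < Real.logb 2 (q / 2) + Typewriter.rateExBSC ε →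
        Typewriter.expurgatedInf (Typewriter.typewriter q ε) R <
          (Typewriter.expurgatedBSC ε (R - Real.logb 2 (q / 2)) : EReal)) ∧
      ¬ (∀ R : ℝ, 0 < R → R < Typewriter.rateCrit q ε →
          Typewriter.reliabilityAvg (Typewriter.typewriter q ε) R =
            Typewriter.expurgatedInf (Typewriter.typewriter q ε) R) ∧
      ¬ (∀ R : ℝ, 0 < R → R < Typewriter.rateCrit q ε →
          Typewriter.reliabilityMax (Typewriter.typewriter q ε) R =
            Typewriter.expurgatedInf (Typewriter.typewriter q ε) R)) := by
  have h2 : 2 ∣ q := heven.two_dvd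
  have hq' : (q : ℝ) ≠ 0 := by exact_mod_cast NeZero.ne q
  have hlogq : Real.logb 2 ((q : ℝ) / 2) = Real.logb 2 q - 1 := by
    rw [Real.logb_div hq' (by norm_num), Real.logb_self_eq_one (by norm_num)]
  have hrel : ∀ R : ℝ, Real.logb 2 (q / 2) < R →
      (Typewriter.expurgatedBSC ε (R - Real.logb 2 (q / 2)) : EReal) ≤
          Typewriter.reliabilityAvg (Typewriter.typewriter q ε) R ∧
      (Typewriter.expurgatedBSC ε (R - Real.logb 2 (q / 2)) : EReal) ≤
          Typewriter.reliabilityMax (Typewriter.typewriter q ε) R := by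
    intro R hR
    simpa only [sub_add_cancel] using
      Typewriter.expurgatedBSC_le_reliability hq h2 hε0 hε (sub_pos.2 hR)
  refine ⟨hrel, fun R hR hRq => ?_, fun hε' => ?_⟩
  · obtain ⟨C₂, hspec, hdim, hcard, hmass⟩ := Typewriter.exists_coset_codes (q := q) h2 hε0 hε
      (sub_pos.2 hR).le (by linarith)
    rw [sub_add_cancel] at hcard
    exact ⟨C₂, hspec, hdim, hcard,
      Typewriter.le_liminf_maxError_cosetCode hq h2 hε0 hε hmass⟩
  · have hpos := Typewriter.rateExBSC_pos hε0 hε'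
    have hlt : ∀ R : ℝ, Real.logb 2 (q / 2) < R →
        R < Real.logb 2 (q / 2) + Typewriter.rateExBSC ε →
        Typewriter.expurgatedInf (Typewriter.typewriter q ε) R <
          (Typewriter.expurgatedBSC ε (R - Real.logb 2 (q / 2)) : EReal) := by
      intro R hR hR'
      simpa only [sub_add_cancel] using
        Typewriter.expurgatedInf_lt hq hε0 hε' (sub_pos.2 hR) (by linarith)
    -- One rate with a strict gap, below the critical rate, refutes the conjectured equality for
    -- both error criteria.
    obtain ⟨R, hR1, hR2⟩ := exists_between
      (lt_min (by linarith : Real.logb 2 ((q : ℝ) / 2) <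
        Real.logb 2 (q / 2) + Typewriter.rateExBSC ε) (Typewriter.logb_lt_rateCrit hε0 hε'))
    have hR0 : 0 < R := by
      refine lt_of_le_of_lt (Real.logb_nonneg (by norm_num) ?_) hR1
      have : (4 : ℝ) ≤ q := by exact_mod_cast hq
      linarith
    have hRex := hR2.trans_le (min_le_left _ _)
    have hRcrit := hR2.trans_le (min_le_right _ _)
    refine ⟨hpos, hlt, fun h => ?_, fun h => ?_⟩
    · exact absurd (h R hR0 hRcrit) ((hlt R hR1 hRex).trans_le (hrel R hR1).1).ne'
    · exact absurd (h R hR0 hRcrit) ((hlt R hR1 hRex).trans_le (hrel R hR1).2).ne'
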